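/- **Permutations.** $\mathfrak S_n$ acts on words of length $n$; $w\in\mathfrak S_n$ moves the letter standing at position $a$ to position $w(a)$, and products are composed from right to left; $s_m=(m,m+1)$. Call $m\in\{1,\dots,n-1\}$ a descent of $w$ if $w(m)>w(m+1)$, and for $I\subseteq\{1,\dots,n-1\}$ let $\operatorname{des}_n(\le I)$ be the set of $w$ whose descents all lie in $I$. For $k+p+q\le n$ let $\mathfrak S_{p,q}^{\uparrow k}\subseteq\mathfrak S_n$ be the set of $w$ which fix every position outside $\{k+1,\dots,k+p+q\}$ and are increasing on $\{k+1,\dots,k+p\}$ and on $\{k+p+1,\dots,k+p+q\}$; $\mathfrak S_{p,q}=\mathfrak S_{p,q}^{\uparrow 0}$. If $w\in \mathfrak S_n$ fixes the last $k$ positions, $w^{\uparrow k}$ is the permutation $a+k\mapsto w(a)+k$ ($1\le a\le n-k$), fixing $1,\dots,k$. Every $w\in\mathfrak S_n$ has a unique bubble decomposition $w=w^{(n-1)}\cdots w^{(1)}$ in which $w^{(k)}$ is either $e$ (put $t_k=0$) or $s_{t_k}s_{t_k+1}\cdots s_k$ with $1\le t_k\le k$; put $t_n=0$. **Lifting shuffles.**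 Let $\mathbb K$ be a field and let $\mathrm{GVB}_n^+$ be the monoid generated by $\sigma_1,\dots,\sigma_{n-1},\xi_1,\dots,\xi_{n-1}$ with the relations $\sigma_a\sigma_b=\sigma_b\sigma_a$, $\sigma_a\xi_b=\xi_b\sigma_a$, $\xi_a\xi_b=\xi_b\xi_a$ for $|a-b|>1$, and $\sigma_a\sigma_{a+1}\sigma_a=\sigma_{a+1}\sigma_a\sigma_{a+1}$, $\xi_a\xi_{a+1}\xi_a=\xi_{a+1}\xi_a\xi_{a+1}$, $\xi_a\sigma_{a+1}\sigma_a=\sigma_{a+1}\sigma_a\xi_{a+1}$, $\xi_{a+1}\sigma_a\sigma_{a+1}=\sigma_a\sigma_{a+1}\xi_a$. Let $l_v(\tau)$ be the number of letters $\xi$ in $\tau\in\mathrm{GVB}_n^+$. For $w\in\mathfrak S_{p,q}^{\uparrow k}$ put $$Q_{p,q}^{\uparrow k}(w)=\prod_{k'=n-1,\dots,1,\ w^{(k')}\ne e}\bigl(\sigma_{t_{k'}}+(1-\delta_{t_{k'}+1,\,t_{k'+1}})\,\sigma_1\cdots\sigma_{t_{k'}-1}\xi_{t_{k'}}\bigr)\sigma_{t_{k'}+1}\cdots\sigma_{k'}\in\mathbb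 K[\mathrm{GVB}_n^+],$$ the factors being written from left to right in the order of decreasing $k'$. For $w\in\mathfrak S_n$ and $p+q=n$ let $\mathbf M'_{p,q}(w,\cdot)$ be the linear endomorphism of $\mathbb K[\mathrm{GVB}_n^+]$ with, for $\tau\in \mathrm{GVB}_n^+$ and $l=l_v(\tau)$, $$\mathbf M'_{p,q}(w,\tau)=Q_{p,q-l}^{\uparrow l}(w^{\uparrow l})\,\tau\ \text{ if } q-l>0 \text{ and } w\in\mathfrak S_{p,q-l},\qquad \mathbf M'_{p,q}(w,\tau)=0\ \text{ otherwise.}$$ Let $1\le i<j<n$ and $I=\{i,j\}$. Multiplication $(L,R)\mapsto LR$ is a bijection $\mathfrak S_{i,n-i}\times\mathfrak S_{j-i,n-j}^{\uparrow i}\to\operatorname{des}_n(\le I)$; let $w\mapsto(w'_L,w'_R)$ be its inverse and $$Q'_{\le I}(w)=\mathbf M'_{i,n-i}\bigl(w'_L,\;Q_{j-i,n-j}^{\uparrow i}(w'_R)\bigr)\qquad(w\in\operatorname{des}_n(\le I)).$$ **Braided algebras.** A braided algebra is a vector space $V$ with linear maps $\sigma:V\otimes V\to V\otimes V$ and $m:V\otimes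 V\to V$ such that $m$ is associative, $(\sigma\otimes\mathrm{id})(\mathrm{id}\otimes\sigma)(\sigma\otimes\mathrm{id})=(\mathrm{id}\otimes\sigma)(\sigma\otimes\mathrm{id})(\mathrm{id}\otimes\sigma)$, $\sigma(\mathrm{id}\otimes m)=(m\otimes\mathrm{id})(\mathrm{id}\otimes\sigma)(\sigma\otimes\mathrm{id})$ and $\sigma(m\otimes\mathrm{id})=(\mathrm{id}\otimes m)(\sigma\otimes\mathrm{id})(\mathrm{id}\otimes\sigma)$ (no unit, and no invertibility of $\sigma$, is required). Let $(\widehat V,\sigma,m)$ be a braided algebra over $\mathbb K$ with an element $\mathbf 1\neq0$ such that $m(\mathbf 1\otimes v)=m(v\otimes\mathbf 1)=v$, $\sigma(\mathbf 1\otimes v)=v\otimes\mathbf 1$ and $\sigma(v\otimes\mathbf 1)=\mathbf 1\otimes v$ for all $v\in\widehat V$, and let $V$ be a linear complement of $\mathbb K\mathbf 1$ in $\widehat V$ to which $\sigma$ and $m$ restrict, making $(V,\sigma,m)$ a braided algebra. Then $\mathbb K[\mathrm{GVB}_n^+]$ acts on $\widehat V^{\otimes n}$: $\sigma_a$ acts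 as $\sigma$ and $\xi_a$ as $\sigma^m:v\otimes w\mapsto\mathbf 1\otimes m(v\otimes w)$ on the tensor factors $a,a+1$. The deleting operator $\mathbf D:T(\widehat V)\to T(V)$ is the linear map that deletes all factors $\mathbf 1$ in a pure tensor each of whose factors is $\mathbf 1$ or lies in $V$. **Quantum quasi-shuffle product.** The product $\ast$ on $T(V)$ is the bilinear map for which the empty word is a two-sided unit and, for $u,v\in V$, $x\in V^{\otimes r}$, $y\in V^{\otimes s}$, $$(u\otimes x)\ast(v\otimes y)=u\otimes\bigl(x\ast(v\otimes y)\bigr)+\sum v'\otimes\bigl(z'\ast y\bigr)+\sum m(u\otimes v'')\otimes\bigl(x''\ast y\bigr),$$ where $\sum v'\otimes z'=\sigma_1\cdots\sigma_{r+1}(u\otimes x\otimes v)$ with $z'\in V^{\otimes(r+1)}$, $\sum v''\otimes x''=\sigma_1\cdots\sigma_{r}(x\otimes v)$ with $x''\in V^{\otimes r}$, and $\sigma_a$ denotes $\sigma$ acting on the factors $a,a+1$. **Theorem.** For all integers $1\le i<j<n$, $I=\{i,j\}$, and all $v_1,\dots,v_n\in V$, $$(v_1\otimes\cdots\otimes v_i)\ast\bigl((v_{i+1}\otimes\cdots\otimes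 v_j)\ast(v_{j+1}\otimes\cdots\otimes v_n)\bigr)=\mathbf D\Bigl(\sum_{w\in\operatorname{des}_n(\le I)}Q'_{\le I}(w)\,(v_1\otimes\cdots\otimes v_n)\Bigr),$$ where on the right-hand side $v_1\otimes\cdots\otimes v_n$ is regarded as an element of $\widehat V^{\otimes n}$. -/

import Mathlib

open scoped TensorProduct

noncomputable section

namespace GMT

/-! ## Permutations, descents and shuffles

Position `a + 1` among `1, …, n` is the element `a : Fin n`.  A permutation `w` moves the letter
standing at position `a` to position `w a`, and products are composed from right to left.  (When
a permutation `s` of positions is written so that it turns the word `x₁ ⋯ xₙ` into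
`x_{s(1)} ⋯ x_{s(n)}`, the function `w` used here is `a ↦ s⁻¹(a)`.) -/

/-- The descents of `w`: all `m` with `1 ≤ m ≤ n - 1` such that `w` reverses the order of the
letters at the positions `m` and `m + 1`. -/
def descents {n : ℕ} (w : Equiv.Perm (Fin n)) : Set ℕ :=
  {m | ∃ a b : Fin n, a.val + 1 = m ∧ b.val = m ∧ w b < w a}

open scoped Classical in
/-- The permutations all of whose descents lie in `I`. -/
def desLE (n : ℕ) (I : Set ℕ) : Finset (Equiv.Perm (Fin n)) :=
  Finset.univ.filter fun w => descents w ⊆ I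

/-- `w` is a `(p, q)`-shuffle of the positions `k + 1, …, k + p + q`. -/
structure IsShuffle {n : ℕ} (k p q : ℕ) (w : Equiv.Perm (Fin n)) : Prop where
  fixed : ∀ a : Fin n, a.val < k ∨ k + p + q ≤ a.val → w a = a
  left : ∀ a b : Fin n, k ≤ a.val → a < b → b.val < k + p → w a < w b
  right : ∀ a b : Fin n, k + p ≤ a.val → a < b → b.val < k + p + q → w a < w b

/-- The permutation `w` moved `k` positions to the right: conjugation by the rotation
`a ↦ a + k` (modulo `n`).  It is used for `w` that fix the last `k` positions. -/
def shiftPerm {n : ℕ} (k : ℕ) (w : Equiv.Perm (Fin n)) : Equiv.Perm (Fin n) :=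
  finRotate n ^ k * w * (finRotate n ^ k)⁻¹

theorem finRotate_pow_apply {n : ℕ} (k : ℕ) (a : Fin n) :
    ((finRotate n ^ k) a).val = (a.val + k) % n := by
  cases n with
  | zero => exact a.elim0
  | succ n =>
    induction k with
    | zero => simp [Nat.mod_eq_of_lt a.isLt]
    | succ k ih =>
      rw [pow_succ', Equiv.Perm.mul_apply, finRotate_apply, Fin.val_add, ih, ← add_assoc]
      simp [Nat.add_mod]

theorem shiftPerm_apply_of_lt {n : ℕ} (k : ℕ) (w : Equiv.Perm (Fin n))
    (hw : ∀ a : Fin n, n - k ≤ a.val → w a = a) (hk : k ≤ n) (a : Fin n) (ha : a.val < k) :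
    shiftPerm k w a = a := by
  have h : ((finRotate n ^ k) ⟨a.val + (n - k), by omega⟩) = a := by
    apply Fin.ext
    rw [finRotate_pow_apply]
    have : a.val + (n - k) + k = a.val + n := by omega
    simp only [this, Nat.add_mod_right]
    exact Nat.mod_eq_of_lt a.isLt
  have h2 : (finRotate n ^ k)⁻¹ a = ⟨a.val + (n - k), by omega⟩ := by
    rw [Equiv.Perm.inv_eq_iff_eq]; exact h.symm
  simp only [shiftPerm, Equiv.Perm.mul_apply, h2]
  rw [hw _ (by simp), h]

theorem shiftPerm_apply_add {n : ℕ} (k : ℕ) (w : Equiv.Perm (Fin n))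
    (hw : ∀ a : Fin n, n - k ≤ a.val → w a = a) (a b : Fin n) (hab : b.val = a.val + k) :
    (shiftPerm k w b).val = (w a).val + k := by
  have h : (finRotate n ^ k) a = b := by
    apply Fin.ext
    rw [finRotate_pow_apply, hab, Nat.mod_eq_of_lt (by omega)]
  have h2 : (finRotate n ^ k)⁻¹ b = a := by
    rw [Equiv.Perm.inv_eq_iff_eq]; exact h.symm
  simp only [shiftPerm, Equiv.Perm.mul_apply, h2]
  rw [finRotate_pow_apply]
  apply Nat.mod_eq_of_lt
  by_contra hlt
  have h3 : w (w a) = w a := hw _ (by omega)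
  have h4 := w.injective h3
  rw [h4] at hlt
  omega

/-! ## The factorisation `w = w'_L * w'_R` -/

theorem rightFactor_bound {n : ℕ} (i : ℕ) (w : Equiv.Perm (Fin n)) (b : Fin n)
    (hb : ¬ b.val < i) :
    i + (Finset.univ.filter fun c : Fin n => i ≤ c.val ∧ w c < w b).card < n := by
  have h1 : (Finset.univ.filter fun c : Fin n => i ≤ c.val ∧ w c < w b) ⊂
      Finset.Ici (⟨i, by omega⟩ : Fin n) := by
    rw [Finset.ssubset_iff_of_subset]
    · refine ⟨b, ?_, ?_⟩
      · simp [Fin.le_def]; omega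
      · simp
    · intro c hc
      simp only [Finset.mem_filter, Finset.mem_univ, true_and] at hc
      simpa [Fin.le_def] using hc.1
  have h2 := Finset.card_lt_card h1
  rw [Fin.card_Ici] at h2
  simp only at h2
  omega

/-- The positions taken by the letters after the last `n - i` letters have been sorted among
themselves as `w` sorts them, the first `i` letters staying in place. -/
def rightFactorFun {n : ℕ} (i : ℕ) (w : Equiv.Perm (Fin n)) (b : Fin n) : Fin n :=
  if hb : b.val < i then b
  else ⟨i + (Finset.univ.filter fun c : Fin n => i ≤ c.val ∧ w c < w b).card,
    rightFactor_bound i w b hb⟩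

theorem rightFactorFun_lt {n : ℕ} (i : ℕ) (w : Equiv.Perm (Fin n)) (b c : Fin n)
    (hb : i ≤ b.val) (hc : i ≤ c.val) (h : w b < w c) :
    rightFactorFun i w b < rightFactorFun i w c := by
  have hlt : (Finset.univ.filter fun d : Fin n => i ≤ d.val ∧ w d < w b).card <
      (Finset.univ.filter fun d : Fin n => i ≤ d.val ∧ w d < w c).card := by
    apply Finset.card_lt_card
    rw [Finset.ssubset_iff_of_subset]
    · exact ⟨b, by simp [hb, h], by simp⟩
    · intro d hd
      simp only [Finset.mem_filter, Finset.mem_univ, true_and] at hd ⊢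
      exact ⟨hd.1, hd.2.trans h⟩
  simp only [rightFactorFun, not_lt.mpr hb, not_lt.mpr hc, dif_neg, not_false_eq_true]
  exact Fin.mk_lt_mk.mpr (Nat.add_lt_add_left hlt i)

theorem rightFactorFun_injective {n : ℕ} (i : ℕ) (w : Equiv.Perm (Fin n)) :
    Function.Injective (rightFactorFun i w) := by
  intro b c hbc
  by_cases hb : b.val < i <;> by_cases hc : c.val < i
  · simpa [rightFactorFun, hb, hc] using hbc
  · simp only [rightFactorFun, hb, hc, dif_pos, dif_neg, not_false_eq_true, Fin.ext_iff] at hbc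
    omega
  · simp only [rightFactorFun, hb, hc, dif_pos, dif_neg, not_false_eq_true, Fin.ext_iff] at hbc
    omega
  · by_contra hne
    rcases lt_or_gt_of_ne (fun h => hne (w.injective h)) with h | h
    · exact (rightFactorFun_lt i w b c (by omega) (by omega) h).ne hbc
    · exact (rightFactorFun_lt i w c b (by omega) (by omega) h).ne hbc.symm

/-- The factor `w'_R`. -/
def rightFactor {n : ℕ} (i : ℕ) (w : Equiv.Perm (Fin n)) : Equiv.Perm (Fin n) :=
  Equiv.ofBijective (rightFactorFun i w)
    (Finite.injective_iff_bijective.mp (rightFactorFun_injective i w))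

/-- The factor `w'_L`. -/
def leftFactor {n : ℕ} (i : ℕ) (w : Equiv.Perm (Fin n)) : Equiv.Perm (Fin n) :=
  w * (rightFactor i w)⁻¹

theorem leftFactor_mul_rightFactor {n : ℕ} (i : ℕ) (w : Equiv.Perm (Fin n)) :
    leftFactor i w * rightFactor i w = w := by
  simp [leftFactor]

theorem rightFactor_of_lt {n : ℕ} (i : ℕ) (w : Equiv.Perm (Fin n)) (b : Fin n)
    (hb : b.val < i) : rightFactor i w b = b := by
  simp [rightFactor, rightFactorFun, hb]

theorem le_of_fixed {n : ℕ} (i : ℕ) (R : Equiv.Perm (Fin n))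
    (hR : ∀ b : Fin n, b.val < i → R b = b) (b : Fin n) (hb : i ≤ b.val) : i ≤ (R b).val := by
  by_contra h
  have := R.injective (hR (R b) (by omega))
  rw [this] at h
  omega

theorem lt_iff_of_strictMono_tail {n : ℕ} (i : ℕ) (L : Equiv.Perm (Fin n))
    (hL : ∀ a b : Fin n, i ≤ a.val → a < b → L a < L b) (a b : Fin n)
    (ha : i ≤ a.val) (hb : i ≤ b.val) : L a < L b ↔ a < b := by
  constructor
  · intro h
    rcases lt_trichotomy a b with h1 | h1 | h1
    · exact h1
    · subst h1; exact absurd h (lt_irrefl _)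
    · exact absurd h (hL b a hb h1).asymm
  · exact hL a b ha

theorem lt_of_descents_subset {n : ℕ} {I : Set ℕ} (w : Equiv.Perm (Fin n))
    (hw : descents w ⊆ I) (a b : Fin n) (hab : a < b)
    (h : ∀ m, a.val < m → m ≤ b.val → m ∉ I) : w a < w b := by
  obtain ⟨d, hd⟩ : ∃ d, b.val = a.val + 1 + d := ⟨b.val - a.val - 1, by omega⟩
  induction d generalizing b with
  | zero =>
    by_contra hlt
    have hne : w b ≠ w a := fun h => hab.ne' (w.injective h)
    exact h b.val (by omega) le_rfl
      (hw ⟨a, b, by omega, rfl, lt_of_le_of_ne (not_lt.mp hlt) hne⟩)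
  | succ d ih =>
    have hlt : a.val + 1 + d < n := by omega
    have h1 := ih ⟨a.val + 1 + d, hlt⟩ (by simp [Fin.lt_def]; omega)
      (fun m h1 h2 => h m h1 (by simp at h2; omega)) rfl
    refine h1.trans ?_
    by_contra hlt'
    have hne : w b ≠ w ⟨a.val + 1 + d, hlt⟩ := fun h => by
      have := congrArg Fin.val (w.injective h); simp at this; omega
    exact h b.val (by omega) le_rfl
      (hw ⟨⟨a.val + 1 + d, hlt⟩, b, by simp; omega, rfl,
        lt_of_le_of_ne (not_lt.mp hlt') hne⟩)

/-- `w ↦ (w'_L, w'_R)` maps the permutations with descents in `{i, j}` to pairs of shuffles. -/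
theorem factors_isShuffle {n i j : ℕ} (hij : i < j) (hj : j < n) (w : Equiv.Perm (Fin n))
    (hw : w ∈ desLE n {i, j}) :
    IsShuffle 0 i (n - i) (leftFactor i w) ∧ IsShuffle i (j - i) (n - j) (rightFactor i w) := by
  have hw' : descents w ⊆ {i, j} := by simpa [desLE] using hw
  have hLR : ∀ a, leftFactor i w (rightFactor i w a) = w a := fun a => by simp [leftFactor]
  have hfix : ∀ a : Fin n, a.val < i → rightFactor i w a = a := rightFactor_of_lt i w
  have hmono : ∀ b c : Fin n, i ≤ b.val → i ≤ c.val → w b < w c →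
      rightFactor i w b < rightFactor i w c := rightFactorFun_lt i w
  refine ⟨⟨?_, ?_, ?_⟩, ⟨?_, ?_, ?_⟩⟩
  · intro a ha; omega
  · intro a b _ hab hb
    rw [← hfix a (by omega), ← hfix b (by omega), hLR, hLR]
    refine lt_of_descents_subset w hw' a b hab ?_
    intro m h1 h2 hm
    simp only [Set.mem_insert_iff, Set.mem_singleton_iff] at hm
    omega
  · intro a b ha hab _
    obtain ⟨a', rfl⟩ := (rightFactor i w).surjective a
    obtain ⟨b', rfl⟩ := (rightFactor i w).surjective b
    rw [hLR, hLR]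
    have ha' : i ≤ a'.val := by
      by_contra h; rw [hfix a' (by omega)] at ha; omega
    have hb' : i ≤ b'.val := by
      by_contra h; rw [hfix b' (by omega)] at hab; omega
    rcases lt_trichotomy (w a') (w b') with h | h | h
    · exact h
    · rw [w.injective h] at hab; exact absurd hab (lt_irrefl _)
    · exact absurd hab (hmono b' a' hb' ha' h).asymm
  · rintro a (ha | ha)
    · exact hfix a ha
    · omega
  · intro a b ha hab hb
    refine hmono a b ha (by omega) (lt_of_descents_subset w hw' a b hab ?_)
    intro m h1 h2 hm
    simp only [Set.mem_insert_iff, Set.mem_singleton_iff] at hm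
    omega
  · intro a b ha hab hb
    refine hmono a b (by omega) (by omega) (lt_of_descents_subset w hw' a b hab ?_)
    intro m h1 h2 hm
    simp only [Set.mem_insert_iff, Set.mem_singleton_iff] at hm
    omega

/-- Multiplication of pairs of shuffles is the inverse of `w ↦ (w'_L, w'_R)`. -/
theorem factors_mul {n i j : ℕ} (hij : i < j) (hj : j < n)
    (L R : Equiv.Perm (Fin n)) (hL : IsShuffle 0 i (n - i) L)
    (hR : IsShuffle i (j - i) (n - j) R) :
    L * R ∈ desLE n {i, j} ∧ leftFactor i (L * R) = L ∧ rightFactor i (L * R) = R := by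
  have hfix : ∀ b : Fin n, b.val < i → R b = b := fun b hb => hR.fixed b (Or.inl hb)
  have htail : ∀ a b : Fin n, i ≤ a.val → a < b → L a < L b :=
    fun a b ha hab => hL.right a b (by omega) hab (by omega)
  have hge := le_of_fixed i R hfix
  have hR2 : rightFactor i (L * R) = R := by
    ext b
    by_cases hb : b.val < i
    · rw [rightFactor_of_lt i _ b hb, hfix b hb]
    · simp only [rightFactor, Equiv.ofBijective_apply, rightFactorFun, hb, dif_neg,
        not_false_eq_true, Equiv.Perm.mul_apply]
      have hset : (Finset.univ.filter fun c : Fin n => i ≤ c.val ∧ L (R c) < L (R b)).card =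
          (Finset.Ico (⟨i, by omega⟩ : Fin n) (R b)).card := by
        rw [← Finset.card_map R.toEmbedding]
        congr 1
        ext c
        simp only [Finset.mem_map, Finset.mem_filter, Finset.mem_univ, true_and,
          Equiv.coe_toEmbedding, Finset.mem_Ico, Fin.le_def]
        constructor
        · rintro ⟨d, ⟨hd, hlt⟩, rfl⟩
          exact ⟨hge d hd, (lt_iff_of_strictMono_tail i L htail _ _ (hge d hd)
            (hge b (by omega))).mp hlt⟩
        · rintro ⟨h1, h2⟩
          obtain ⟨d, rfl⟩ := R.surjective c
          have hd : i ≤ d.val := by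
            by_contra h; rw [hfix d (by omega)] at h1; omega
          exact ⟨d, ⟨hd, htail _ _ h1 h2⟩, rfl⟩
      refine (congrArg (i + ·) hset).trans ?_
      have := hge b (by omega)
      simp only [Fin.card_Ico]
      omega
  refine ⟨?_, ?_, hR2⟩
  · simp only [desLE, Finset.mem_filter, Finset.mem_univ, true_and]
    rintro m ⟨a, b, ha, hb, hlt⟩
    simp only [Set.mem_insert_iff, Set.mem_singleton_iff]
    by_contra hm
    push Not at hm
    simp only [Equiv.Perm.mul_apply] at hlt
    refine absurd hlt (lt_asymm ?_)
    rcases lt_or_ge b.val i with h | h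
    · rw [hfix a (by omega), hfix b h]
      exact hL.left a b (by omega) (by omega) (by omega)
    · refine htail _ _ (hge a (by omega)) ?_
      rcases lt_or_ge b.val j with h' | h'
      · exact hR.left a b (by omega) (by omega) (by omega)
      · exact hR.right a b (by omega) (by omega) (by omega)
  · rw [leftFactor, hR2, mul_inv_cancel_right]

/-! ## The bubble decomposition -/

/-- The product `g_a g_{a+1} ⋯ g_b`. -/
def runProd {M : Type*} [Monoid M] (g : ℕ → M) (a b : ℕ) : M :=
  ((List.range' a (b + 1 - a)).map g).prod

/-- The product `g_{n-1} g_{n-2} ⋯ g_1`. -/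
def descProd {M : Type*} [Monoid M] (g : ℕ → M) (n : ℕ) : M :=
  ((List.range' 1 (n - 1)).reverse.map g).prod

/-- The transposition `s_m` of the positions `m` and `m + 1`, for `1 ≤ m ≤ n - 1`. -/
def simpleTransp (n m : ℕ) : Equiv.Perm (Fin n) :=
  if h : 1 ≤ m ∧ m < n then Equiv.swap ⟨m - 1, by omega⟩ ⟨m, h.2⟩ else 1

/-- The numbers `t_k` of the bubble decomposition `w = w^(n-1) ⋯ w^(1)`, whose `k`-th factor is
`w^(k) = s_{t_k} s_{t_k + 1} ⋯ s_k` if `t_k ≠ 0` and `w^(k) = e` if `t_k = 0`; see `descProd_bubble`.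
Explicitly, `t_k` is the rank of the letter `k + 1` among the letters `1, …, k + 1` after `w` has
moved them, replaced by `0` if that rank is `k + 1`. -/
def bubbleIndex {n : ℕ} (w : Equiv.Perm (Fin n)) (k : ℕ) : ℕ :=
  if h : k < n then
    let r := (Finset.univ.filter fun a : Fin n => a.val ≤ k ∧ w a ≤ w ⟨k, h⟩).card
    if r ≤ k then r else 0
  else 0

/-- The factor `w^(k)`. -/
def bubbleFactor {n : ℕ} (w : Equiv.Perm (Fin n)) (k : ℕ) : Equiv.Perm (Fin n) :=
  if bubbleIndex w k = 0 then 1 else runProd (simpleTransp n) (bubbleIndex w k) k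

theorem runProd_eq_mul {M : Type*} [Monoid M] (g : ℕ → M) (a b : ℕ) (h : a ≤ b) :
    runProd g a b = g a * runProd g (a + 1) b := by
  obtain ⟨d, rfl⟩ := Nat.exists_eq_add_of_le h
  simp only [runProd]
  rw [show a + d + 1 - a = d + 1 by omega, show a + d + 1 - (a + 1) = d by omega,
    List.range'_succ]
  simp

theorem simpleTransp_apply {n m : ℕ} (h1 : 1 ≤ m) (h2 : m < n) (x : Fin n) :
    (simpleTransp n m x).val =
      if x.val = m then m - 1 else if x.val + 1 = m then m else x.val := by
  simp only [simpleTransp, h1, h2, and_self, dif_pos, Equiv.swap_apply_def]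
  simp only [Fin.ext_iff]
  split_ifs <;> first | rfl | omega

theorem runProd_simpleTransp_apply {n t k : ℕ} (ht : 1 ≤ t) (htk : t ≤ k + 1) (hk : k < n)
    (x : Fin n) :
    (runProd (simpleTransp n) t k x).val =
      if x.val = k then t - 1 else if t ≤ x.val + 1 ∧ x.val < k then x.val + 1 else x.val := by
  obtain ⟨d, hd⟩ := Nat.exists_eq_add_of_le htk
  induction d generalizing t with
  | zero =>
    have : runProd (simpleTransp n) t k = 1 := by simp [runProd, hd]
    rw [this]
    simp only [Equiv.Perm.coe_one, id_eq]
    split_ifs <;> omega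
  | succ d ih =>
    rw [runProd_eq_mul _ _ _ (by omega), Equiv.Perm.mul_apply,
      simpleTransp_apply ht (by omega), ih (by omega) (by omega) (by omega)]
    split_ifs <;> omega

/-- The rank of the letter `a` among the letters `1, …, k + 1` (counted from `0`). -/
def bubbleRank {n : ℕ} (w : Equiv.Perm (Fin n)) (k : ℕ) (a : Fin n) : ℕ :=
  if a.val ≤ k then (Finset.univ.filter fun c : Fin n => c.val ≤ k ∧ w c < w a).card else a.val

theorem bubbleFactor_apply {n : ℕ} (w : Equiv.Perm (Fin n)) (k : ℕ) (hk : k + 1 < n)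
    (a x : Fin n) (hx : x.val = bubbleRank w k a) :
    (bubbleFactor w (k + 1) x).val = bubbleRank w (k + 1) a := by
  set b : Fin n := ⟨k + 1, hk⟩ with hb
  set S := Finset.univ.filter fun c : Fin n => c.val ≤ k ∧ w c < w b with hS
  have hcardle : ∀ p : Fin n → Prop, [DecidablePred p] →
      (Finset.univ.filter fun c : Fin n => c.val ≤ k ∧ p c).card ≤ k + 1 := by
    intro p _
    refine (Finset.card_le_card (t := Finset.Iic ⟨k, by omega⟩) ?_).trans (by simp)
    intro c hc
    simp only [Finset.mem_filter, Finset.mem_univ, true_and] at hc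
    simpa [Fin.le_def] using hc.1
  have hr : (Finset.univ.filter fun c : Fin n => c.val ≤ k + 1 ∧ w c ≤ w b).card
      = S.card + 1 := by
    rw [← Finset.card_insert_of_notMem (a := b) (s := S) (by simp [hS])]
    congr 1
    ext c
    simp only [Finset.mem_filter, Finset.mem_univ, true_and, Finset.mem_insert, hS]
    constructor
    · rintro ⟨h1, h2⟩
      rcases h2.lt_or_eq with h | h
      · right
        refine ⟨?_, h⟩
        by_contra h3
        have : c = b := Fin.ext (by simp [hb]; omega)
        rw [this] at h
        exact lt_irrefl _ h
      · left; exact w.injective h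
    · rintro (h | h)
      · subst h; simp [hb]
      · exact ⟨by omega, h.2.le⟩
  have hSle : S.card ≤ k + 1 := hcardle _
  have hidx : bubbleIndex w (k + 1) = if S.card + 1 ≤ k + 1 then S.card + 1 else 0 := by
    have : bubbleIndex w (k + 1) =
        if (Finset.univ.filter fun c : Fin n => c.val ≤ k + 1 ∧ w c ≤ w b).card ≤ k + 1 then
        (Finset.univ.filter fun c : Fin n => c.val ≤ k + 1 ∧ w c ≤ w b).card else 0 := by
      simp only [bubbleIndex, hk, dif_pos, hb]
    rw [this, hr]
  have hfac : (bubbleFactor w (k + 1) x).val =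
      if x.val = k + 1 then S.card
      else if S.card ≤ x.val ∧ x.val < k + 1 then x.val + 1 else x.val := by
    by_cases h : S.card + 1 ≤ k + 1
    · simp only [bubbleFactor, hidx, h, if_true]
      rw [if_neg (by omega), runProd_simpleTransp_apply (by omega) (by omega) hk]
      split_ifs <;> omega
    · simp only [bubbleFactor, hidx, h, if_false, if_true, Equiv.Perm.coe_one, id_eq]
      split_ifs <;> omega
  rw [hfac, hx]
  have hrb : (Finset.univ.filter fun c : Fin n => c.val ≤ k + 1 ∧ w c < w b) = S := by
    ext c
    simp only [Finset.mem_filter, Finset.mem_univ, true_and, hS]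
    constructor
    · rintro ⟨h1, h2⟩
      refine ⟨?_, h2⟩
      by_contra h3
      have : c = b := Fin.ext (by simp [hb]; omega)
      rw [this] at h2
      exact lt_irrefl _ h2
    · rintro ⟨h1, h2⟩
      exact ⟨by omega, h2⟩
  rcases lt_trichotomy a.val (k + 1) with ha | ha | ha
  · have hak : a.val ≤ k := by omega
    have hrl : (Finset.univ.filter fun c : Fin n => c.val ≤ k ∧ w c < w a).card < k + 1 := by
      have h1 : (Finset.univ.filter fun c : Fin n => c.val ≤ k ∧ w c < w a) ⊂
          (Finset.univ.filter fun c : Fin n => c.val ≤ k ∧ w c ≤ w a) := by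
        rw [Finset.ssubset_iff_of_subset]
        · exact ⟨a, by simp [hak], by simp⟩
        · intro c hc
          simp only [Finset.mem_filter, Finset.mem_univ, true_and] at hc ⊢
          exact ⟨hc.1, hc.2.le⟩
      exact (Finset.card_lt_card h1).trans_le (hcardle _)
    have e1 : bubbleRank w k a =
        (Finset.univ.filter fun c : Fin n => c.val ≤ k ∧ w c < w a).card := by
      simp [bubbleRank, hak]
    have e2 : bubbleRank w (k + 1) a =
        (Finset.univ.filter fun c : Fin n => c.val ≤ k + 1 ∧ w c < w a).card := by
      simp [bubbleRank, ha.le]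
    have hne : w a ≠ w b := fun h => by
      have := congrArg Fin.val (w.injective h); simp [hb] at this; omega
    rcases lt_or_gt_of_ne hne with h | h
    · have hlt : (Finset.univ.filter fun c : Fin n => c.val ≤ k ∧ w c < w a).card < S.card := by
        apply Finset.card_lt_card
        rw [Finset.ssubset_iff_of_subset]
        · exact ⟨a, by simp [hS, hak, h], by simp⟩
        · intro c hc
          simp only [Finset.mem_filter, Finset.mem_univ, true_and, hS] at hc ⊢
          exact ⟨hc.1, hc.2.trans h⟩
      have he : (Finset.univ.filter fun c : Fin n => c.val ≤ k + 1 ∧ w c < w a) =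
          (Finset.univ.filter fun c : Fin n => c.val ≤ k ∧ w c < w a) := by
        ext c
        simp only [Finset.mem_filter, Finset.mem_univ, true_and]
        constructor
        · rintro ⟨h1, h2⟩
          refine ⟨?_, h2⟩
          by_contra h3
          have : c = b := Fin.ext (by simp [hb]; omega)
          rw [this] at h2
          exact lt_asymm h2 h
        · rintro ⟨h1, h2⟩
          exact ⟨by omega, h2⟩
      rw [e2, he, e1]
      split_ifs <;> omega
    · have hle : S.card ≤ (Finset.univ.filter fun c : Fin n => c.val ≤ k ∧ w c < w a).card := by
        apply Finset.card_le_card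
        intro c hc
        simp only [Finset.mem_filter, Finset.mem_univ, true_and, hS] at hc ⊢
        exact ⟨hc.1, hc.2.trans h⟩
      have he : (Finset.univ.filter fun c : Fin n => c.val ≤ k + 1 ∧ w c < w a).card =
          (Finset.univ.filter fun c : Fin n => c.val ≤ k ∧ w c < w a).card + 1 := by
        rw [← Finset.card_insert_of_notMem (a := b) (by simp [hb])]
        congr 1
        ext c
        simp only [Finset.mem_filter, Finset.mem_univ, true_and, Finset.mem_insert]
        constructor
        · rintro ⟨h1, h2⟩
          by_cases h3 : c.val ≤ k
          · exact Or.inr ⟨h3, h2⟩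
          · exact Or.inl (Fin.ext (by simp [hb]; omega))
        · rintro (h3 | ⟨h1, h2⟩)
          · subst h3; exact ⟨by simp [hb], h⟩
          · exact ⟨by omega, h2⟩
      rw [e2, he, e1]
      split_ifs <;> omega
  · have hab : a = b := Fin.ext (by simp [hb, ha])
    have e1 : bubbleRank w k a = k + 1 := by simp [bubbleRank, ha]
    have e2 : bubbleRank w (k + 1) a = S.card := by
      simp only [bubbleRank, ha, le_refl, if_true]
      rw [hab, hrb]
    rw [e1, e2]; simp
  · have e1 : bubbleRank w k a = a.val := by simp [bubbleRank]; omega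
    have e2 : bubbleRank w (k + 1) a = a.val := by simp [bubbleRank]; omega
    rw [e1, e2]
    split_ifs <;> omega

theorem bubbleRank_last {n : ℕ} (w : Equiv.Perm (Fin n)) (a : Fin n) :
    bubbleRank w (n - 1) a = (w a).val := by
  have h1 : ∀ c : Fin n, c.val ≤ n - 1 := fun c => by omega
  simp only [bubbleRank, h1, true_and, if_true]
  rw [← Finset.card_map w.toEmbedding]
  have : (Finset.univ.filter fun c : Fin n => w c < w a).map w.toEmbedding =
      Finset.Iio (w a) := by
    ext c
    simp only [Finset.mem_map, Finset.mem_filter, Finset.mem_univ, true_and,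
      Equiv.coe_toEmbedding, Finset.mem_Iio]
    constructor
    · rintro ⟨d, h, rfl⟩; exact h
    · intro h
      exact ⟨w.symm c, by simpa using h, by simp⟩
  rw [this, Fin.card_Iio]

/-- The bubble decomposition `w = w^(n-1) w^(n-2) ⋯ w^(1)`. -/
theorem descProd_bubble {n : ℕ} (w : Equiv.Perm (Fin n)) : descProd (bubbleFactor w) n = w := by
  have key : ∀ k, k < n → ∀ a : Fin n,
      (((List.range' 1 k).reverse.map (bubbleFactor w)).prod a).val = bubbleRank w k a := by
    intro k
    induction k with
    | zero =>
      intro hn a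
      simp only [List.range'_zero, List.reverse_nil, List.map_nil, List.prod_nil,
        Equiv.Perm.coe_one, id_eq, bubbleRank]
      split_ifs with h
      · have : (Finset.univ.filter fun c : Fin n => c.val ≤ 0 ∧ w c < w a) = ∅ := by
          rw [Finset.filter_eq_empty_iff]
          rintro c - ⟨h1, h2⟩
          have : c = a := Fin.ext (by omega)
          rw [this] at h2
          exact lt_irrefl _ h2
        rw [this]; simp; omega
      · rfl
    | succ k ih =>
      intro hk a
      rw [List.range'_concat, List.reverse_append]
      simp only [List.reverse_cons, List.reverse_nil, List.nil_append, List.map_append,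
        List.map_cons, List.map_nil, List.prod_append, List.prod_cons, List.prod_nil, mul_one,
        Equiv.Perm.mul_apply, one_mul]
      rw [add_comm 1 k]
      exact bubbleFactor_apply w k hk a _ (ih (by omega) a)
  ext a
  have hn : n - 1 < n := by have := a.isLt; omega
  rw [descProd, key (n - 1) hn a, bubbleRank_last]

/-! ## The generalized virtual braid monoid and the lift of shuffles -/

/-- The generators `σ_{a+1}` (`sig a`) and `ξ_{a+1}` (`xi a`), for `a = 0, …, n - 2`. -/
inductive GVBGen (n : ℕ) : Type
  | sig : Fin (n - 1) → GVBGen n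
  | xi : Fin (n - 1) → GVBGen n

open GVBGen FreeMonoid in
/-- The defining relations of `GVB_n⁺`. -/
inductive GVBRel (n : ℕ) : FreeMonoid (GVBGen n) → FreeMonoid (GVBGen n) → Prop
  | sig_sig (a b : Fin (n - 1)) (h : a.val + 1 < b.val ∨ b.val + 1 < a.val) :
      GVBRel n (of (sig a) * of (sig b)) (of (sig b) * of (sig a))
  | sig_xi (a b : Fin (n - 1)) (h : a.val + 1 < b.val ∨ b.val + 1 < a.val) :
      GVBRel n (of (sig a) * of (xi b)) (of (xi b) * of (sig a))
  | xi_xi (a b : Fin (n - 1)) (h : a.val + 1 < b.val ∨ b.val + 1 < a.val) :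
      GVBRel n (of (xi a) * of (xi b)) (of (xi b) * of (xi a))
  | braid_sig (a b : Fin (n - 1)) (h : b.val = a.val + 1) :
      GVBRel n (of (sig a) * of (sig b) * of (sig a)) (of (sig b) * of (sig a) * of (sig b))
  | braid_xi (a b : Fin (n - 1)) (h : b.val = a.val + 1) :
      GVBRel n (of (xi a) * of (xi b) * of (xi a)) (of (xi b) * of (xi a) * of (xi b))
  | mixed_left (a b : Fin (n - 1)) (h : b.val = a.val + 1) :
      GVBRel n (of (xi a) * of (sig b) * of (sig a)) (of (sig b) * of (sig a) * of (xi b))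
  | mixed_right (a b : Fin (n - 1)) (h : b.val = a.val + 1) :
      GVBRel n (of (xi b) * of (sig a) * of (sig b)) (of (sig a) * of (sig b) * of (xi a))

/-- The generalized virtual braid monoid `GVB_n⁺`. -/
abbrev GVBMonoid (n : ℕ) : Type := PresentedMonoid (GVBRel n)

/-- The virtual length `l_v`, the number of letters `ξ_i` in any word for an element. -/
def virtualLengthHom (n : ℕ) : GVBMonoid n →* Multiplicative ℕ :=
  PresentedMonoid.lift
    (fun g => match g with
      | .sig _ => Multiplicative.ofAdd 0
      | .xi _ => Multiplicative.ofAdd 1)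
    (by
      intro x y h
      cases h <;> simp only [map_mul, FreeMonoid.lift_eval_of] <;> rfl)

def virtualLength {n : ℕ} (τ : GVBMonoid n) : ℕ := (virtualLengthHom n τ).toAdd

section lifts

variable (K : Type*) [Field K]

/-- `σ_m` in the algebra of `GVB_n⁺`, for `1 ≤ m ≤ n - 1`. -/
def sigAlg (n m : ℕ) : MonoidAlgebra K (GVBMonoid n) :=
  if h : 1 ≤ m ∧ m < n then
    MonoidAlgebra.of K _ (PresentedMonoid.of (GVBRel n) (.sig ⟨m - 1, by omega⟩))
  else 1

/-- `ξ_m` in the algebra of `GVB_n⁺`, for `1 ≤ m ≤ n - 1`. -/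
def xiAlg (n m : ℕ) : MonoidAlgebra K (GVBMonoid n) :=
  if h : 1 ≤ m ∧ m < n then
    MonoidAlgebra.of K _ (PresentedMonoid.of (GVBRel n) (.xi ⟨m - 1, by omega⟩))
  else 1

/-- The factor
`(σ_{t_k} + (1 - δ_{t_k + 1, t_{k+1}}) σ_1 ⋯ σ_{t_k - 1} ξ_{t_k}) σ_{t_k + 1} ⋯ σ_k`
attached to `w^(k) ≠ e`; it is `1` if `w^(k) = e`. -/
def liftFactor {n : ℕ} (w : Equiv.Perm (Fin n)) (k : ℕ) : MonoidAlgebra K (GVBMonoid n) :=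
  let t := bubbleIndex w k
  if t = 0 then 1
  else
    (sigAlg K n t +
      if t + 1 = bubbleIndex w (k + 1) then 0
      else runProd (sigAlg K n) 1 (t - 1) * xiAlg K n t) *
    runProd (sigAlg K n) (t + 1) k

open scoped Classical in
/-- The lift of the `(p, q)`-shuffles of the positions `k + 1, …, k + p + q`, extended by zero to
all permutations. -/
def liftShuffle {n : ℕ} (k p q : ℕ) (w : Equiv.Perm (Fin n)) : MonoidAlgebra K (GVBMonoid n) :=
  if IsShuffle k p q w then descProd (liftFactor K w) n else 0

open scoped Classical in
/-- `M'_{p,q}(w, τ)` for a permutation `w` and an element `τ` of the monoid `GVB_n⁺`: if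
`q > l = l_v(τ)` and `w` is a `(p, q - l)`-shuffle, the lift of `w`, acting on the positions
`l + 1, …, l + p + (q - l)`, times `τ`. -/
def liftMulMonoid {n : ℕ} (p q : ℕ) (w : Equiv.Perm (Fin n)) (τ : GVBMonoid n) :
    MonoidAlgebra K (GVBMonoid n) :=
  if virtualLength τ < q ∧ IsShuffle 0 p (q - virtualLength τ) w then
    liftShuffle K (virtualLength τ) p (q - virtualLength τ) (shiftPerm (virtualLength τ) w) *
      MonoidAlgebra.of K _ τ
  else 0

/-- `M'_{p,q}(w, ·)`, extended linearly. -/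
def liftMul {n : ℕ} (p q : ℕ) (w : Equiv.Perm (Fin n)) :
    MonoidAlgebra K (GVBMonoid n) →ₗ[K] MonoidAlgebra K (GVBMonoid n) :=
  Finsupp.linearCombination K (liftMulMonoid K p q w) ∘ₗ
    (MonoidAlgebra.coeffLinearEquiv K).toLinearMap

/-- `Q'_{≤ {i, j}}(w) = M'_{i, n-i}(w'_L, Q_{j-i, n-j}^{↑ i}(w'_R))`. -/
def liftTwo {n : ℕ} (i j : ℕ) (w : Equiv.Perm (Fin n)) : MonoidAlgebra K (GVBMonoid n) :=
  liftMul K i (n - i) (leftFactor i w) (liftShuffle K i (j - i) (n - j) (rightFactor i w))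

end lifts

/-! ## Tensor powers and operators on adjacent factors -/

section tensors

variable {K : Type*} [Field K] {V : Type*} [AddCommGroup V] [Module K V]

variable (K V) in
/-- `V ⊗ V^{⊗ n} ≃ V^{⊗ (n + 1)}`, `v ⊗ (v₁ ⊗ ⋯ ⊗ vₙ) ↦ v ⊗ v₁ ⊗ ⋯ ⊗ vₙ`. -/
def consEquiv (n : ℕ) : (V ⊗[K] (⨂[K]^n V)) ≃ₗ[K] (⨂[K]^(n + 1) V) :=
  TensorProduct.congr (PiTensorProduct.subsingletonEquiv (s := fun _ => V) (0 : Fin 1)).symm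
    (LinearEquiv.refl K _) ≪≫ₗ TensorPower.mulEquiv ≪≫ₗ TensorPower.cast K V (Nat.add_comm 1 n)

theorem consEquiv_tprod {n : ℕ} (v : V) (x : Fin n → V) :
    consEquiv K V n (v ⊗ₜ PiTensorProduct.tprod K x) =
      PiTensorProduct.tprod K (Fin.cons v x : Fin (n + 1) → V) := by
  simp only [consEquiv, LinearEquiv.trans_apply, TensorProduct.congr_tmul,
    PiTensorProduct.subsingletonEquiv_symm_apply', LinearEquiv.refl_apply]
  rw [← TensorPower.gMul_def, TensorPower.tprod_mul_tprod, TensorPower.cast_tprod]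
  congr 1
  funext a
  rw [Fin.append_left_eq_cons]
  simp

/-- `f ⊗ id` on `V ⊗ V ⊗ X`. -/
def onFirstTwo (f : V ⊗[K] V →ₗ[K] V ⊗[K] V) (X : Type*) [AddCommGroup X] [Module K X] :
    Module.End K (V ⊗[K] (V ⊗[K] X)) :=
  (TensorProduct.assoc K V V X).toLinearMap ∘ₗ LinearMap.rTensor X f ∘ₗ
    (TensorProduct.assoc K V V X).symm.toLinearMap

/-- `id^{⊗ a} ⊗ f ⊗ id^{⊗ (n - a - 2)}` on `V^{⊗ n}`, for `f ∈ End (V ⊗ V)` and `a + 2 ≤ n`. -/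
def opAt (f : V ⊗[K] V →ₗ[K] V ⊗[K] V) : (n a : ℕ) → Module.End K (⨂[K]^n V)
  | 0, _ => 1
  | n + 1, a + 1 => (consEquiv K V n).conj (LinearMap.lTensor V (opAt f n a))
  | 1, 0 => 1
  | n + 2, 0 =>
    (consEquiv K V (n + 1)).conj ((LinearEquiv.lTensor V (consEquiv K V n)).conj
      (onFirstTwo f (⨂[K]^n V)))

theorem conj_mul' {M N : Type*} [AddCommGroup M] [Module K M] [AddCommGroup N] [Module K N]
    (e : M ≃ₗ[K] N) (f g : Module.End K M) : e.conj (f * g) = e.conj f * e.conj g := by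
  ext x; simp [LinearEquiv.conj_apply]

/-- Conjugation by a linear equivalence as a homomorphism of monoids. -/
def conjHom {M N : Type*} [AddCommGroup M] [Module K M] [AddCommGroup N] [Module K N]
    (e : M ≃ₗ[K] N) : Module.End K M →* Module.End K N where
  toFun := e.conj
  map_one' := by ext x; simp [LinearEquiv.conj_apply]
  map_mul' := conj_mul' e

/-- `g ↦ id ⊗ g` as a homomorphism of monoids. -/
def lTensorHom (M : Type*) [AddCommGroup M] [Module K M] (N : Type*) [AddCommGroup N]
    [Module K N] : Module.End K N →* Module.End K (M ⊗[K] N) where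
  toFun := LinearMap.lTensor M
  map_one' := LinearMap.lTensor_id M N
  map_mul' := LinearMap.lTensor_comp M

/-- `g ↦ g ⊗ id` as a homomorphism of monoids. -/
def rTensorHom (M : Type*) [AddCommGroup M] [Module K M] (N : Type*) [AddCommGroup N]
    [Module K N] : Module.End K N →* Module.End K (N ⊗[K] M) where
  toFun := LinearMap.rTensor M
  map_one' := LinearMap.rTensor_id M N
  map_mul' := LinearMap.rTensor_comp M

theorem opAt_succ (f : V ⊗[K] V →ₗ[K] V ⊗[K] V) (n a : ℕ) :
    opAt f (n + 1) (a + 1) = conjHom (consEquiv K V n) (lTensorHom V _ (opAt f n a)) := rfl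

theorem opAt_zero (f : V ⊗[K] V →ₗ[K] V ⊗[K] V) (n : ℕ) :
    opAt f (n + 2) 0 = conjHom (consEquiv K V (n + 1))
      (conjHom (LinearEquiv.lTensor V (consEquiv K V n)) (onFirstTwo f (⨂[K]^n V))) := rfl

theorem conjHom_lTensor {M N X : Type*} [AddCommGroup M] [Module K M] [AddCommGroup N]
    [Module K N] [AddCommGroup X] [Module K X] (e : M ≃ₗ[K] N) (g : Module.End K M) :
    lTensorHom X _ (conjHom e g) = conjHom (LinearEquiv.lTensor X e) (lTensorHom X _ g) := by
  apply TensorProduct.ext'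
  intro x y
  simp [lTensorHom, conjHom, LinearEquiv.conj_apply]

theorem onFirstTwo_commute (f : V ⊗[K] V →ₗ[K] V ⊗[K] V) {X : Type*} [AddCommGroup X]
    [Module K X] (g : Module.End K X) :
    Commute (onFirstTwo f X) (lTensorHom V _ (lTensorHom V _ g)) := by
  have h : ∀ (t : V ⊗[K] V) (z : X),
      LinearMap.lTensor V (LinearMap.lTensor V g) (TensorProduct.assoc K V V X (t ⊗ₜ z)) =
        TensorProduct.assoc K V V X (t ⊗ₜ g z) := by
    intro t z
    induction t with
    | zero => simp
    | tmul a b => simp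
    | add a b ha hb => simp only [TensorProduct.add_tmul, map_add, ha, hb]
  refine LinearMap.ext fun t => ?_
  induction t with
  | zero => simp
  | add a b ha hb => simp only [map_add, ha, hb]
  | tmul x t =>
    induction t with
    | zero => simp
    | add a b ha hb => simp only [TensorProduct.tmul_add, map_add, ha, hb]
    | tmul y z =>
      simp [onFirstTwo, lTensorHom, h]

theorem opAt_commute (f g : V ⊗[K] V →ₗ[K] V ⊗[K] V) (n a b : ℕ) (hab : a + 1 < b)
    (hb : b + 2 ≤ n) : Commute (opAt f n a) (opAt g n b) := by
  induction a generalizing n b with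
  | zero =>
    obtain ⟨c, rfl⟩ : ∃ c, b = c + 2 := ⟨b - 2, by omega⟩
    obtain ⟨k, rfl⟩ : ∃ k, n = k + 2 := ⟨n - 2, by omega⟩
    rw [opAt_zero, opAt_succ, opAt_succ, conjHom_lTensor]
    exact ((onFirstTwo_commute f _).map _).map _
  | succ a ih =>
    obtain ⟨c, rfl⟩ : ∃ c, b = c + 1 := ⟨b - 1, by omega⟩
    obtain ⟨k, rfl⟩ : ∃ k, n = k + 1 := ⟨n - 1, by omega⟩
    rw [opAt_succ, opAt_succ]
    exact ((ih k c (by omega) (by omega)).map _).map _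

/-- `(V ⊗ (V ⊗ V)) ⊗ X ≃ V ⊗ (V ⊗ (V ⊗ X))`. -/
def assocThree (V : Type*) [AddCommGroup V] [Module K V] (X : Type*) [AddCommGroup X]
    [Module K X] : ((V ⊗[K] (V ⊗[K] V)) ⊗[K] X) ≃ₗ[K] (V ⊗[K] (V ⊗[K] (V ⊗[K] X))) :=
  TensorProduct.assoc K V (V ⊗[K] V) X ≪≫ₗ LinearEquiv.lTensor V (TensorProduct.assoc K V V X)

theorem assocThree_first (f : V ⊗[K] V →ₗ[K] V ⊗[K] V) (X : Type*) [AddCommGroup X]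
    [Module K X] :
    conjHom (assocThree V X) (rTensorHom X _ (onFirstTwo f V)) = onFirstTwo f (V ⊗[K] X) := by
  have h : ∀ (t : V ⊗[K] V) (z : V) (u : X),
      assocThree V X (TensorProduct.assoc K V V V (t ⊗ₜ z) ⊗ₜ u) =
        TensorProduct.assoc K V V (V ⊗[K] X) (t ⊗ₜ (z ⊗ₜ u)) := by
    intro t z u
    induction t with
    | zero => simp
    | tmul a b => simp [assocThree]
    | add a b ha hb => simp only [TensorProduct.add_tmul, map_add, ha, hb]
  have h2 : ∀ x y z (u : X), (assocThree V X).symm (x ⊗ₜ (y ⊗ₜ (z ⊗ₜ u))) =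
      (x ⊗ₜ[K] (y ⊗ₜ[K] z)) ⊗ₜ[K] u := by
    intro x y z u
    rw [LinearEquiv.symm_apply_eq]; simp [assocThree]
  apply TensorProduct.ext'
  intro x t
  induction t with
  | zero => simp
  | add a b ha hb => simp only [TensorProduct.tmul_add, map_add, ha, hb]
  | tmul y t =>
    induction t with
    | zero => simp
    | add a b ha hb => simp only [TensorProduct.tmul_add, map_add, ha, hb]
    | tmul z u =>
      simp [conjHom, LinearEquiv.conj_apply, rTensorHom, h2, onFirstTwo, h]

theorem assocThree_second (f : V ⊗[K] V →ₗ[K] V ⊗[K] V) (X : Type*) [AddCommGroup X]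
    [Module K X] :
    conjHom (assocThree V X) (rTensorHom X _ (LinearMap.lTensor V f)) =
      lTensorHom V _ (onFirstTwo f X) := by
  apply TensorProduct.ext'
  intro x t
  induction t with
  | zero => simp
  | add a b ha hb => simp only [TensorProduct.tmul_add, map_add, ha, hb]
  | tmul y t =>
    induction t with
    | zero => simp
    | add a b ha hb => simp only [TensorProduct.tmul_add, map_add, ha, hb]
    | tmul z u =>
      simp [conjHom, LinearEquiv.conj_apply, rTensorHom, lTensorHom, onFirstTwo, assocThree]

/-- Operators on three adjacent factors extend operators on `V ⊗ V ⊗ V`. -/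
theorem exists_opAt_three (K : Type*) [Field K] (V : Type*) [AddCommGroup V] [Module K V]
    (n a : ℕ) (h : a + 3 ≤ n) :
    ∃ Θ : Module.End K (V ⊗[K] (V ⊗[K] V)) →* Module.End K (⨂[K]^n V),
      ∀ f : V ⊗[K] V →ₗ[K] V ⊗[K] V,
        Θ (onFirstTwo f V) = opAt f n a ∧ Θ (LinearMap.lTensor V f) = opAt f n (a + 1) := by
  induction a generalizing n with
  | zero =>
    obtain ⟨k, rfl⟩ : ∃ k, n = k + 3 := ⟨n - 3, by omega⟩
    refine ⟨(conjHom (consEquiv K V (k + 2))).comp ((conjHom (LinearEquiv.lTensor V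
      (consEquiv K V (k + 1)))).comp ((conjHom (LinearEquiv.lTensor V (LinearEquiv.lTensor V
      (consEquiv K V k)))).comp ((conjHom (assocThree V (⨂[K]^k V))).comp
      (rTensorHom (⨂[K]^k V) _)))), fun f => ⟨?_, ?_⟩⟩
    · simp only [MonoidHom.comp_apply]
      rw [assocThree_first, opAt_zero]
      congr 2
      have h : ∀ (t : V ⊗[K] V) (z : V ⊗[K] (⨂[K]^k V)),
          LinearMap.lTensor V (LinearMap.lTensor V (consEquiv K V k).toLinearMap)
            (TensorProduct.assoc K V V _ (t ⊗ₜ z)) =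
          TensorProduct.assoc K V V _ (t ⊗ₜ consEquiv K V k z) := by
        intro t z
        induction t with
        | zero => simp
        | tmul a b => simp
        | add a b ha hb => simp only [TensorProduct.add_tmul, map_add, ha, hb]
      apply TensorProduct.ext'
      intro x t
      induction t with
      | zero => simp
      | add a b ha hb => simp only [TensorProduct.tmul_add, map_add, ha, hb]
      | tmul y t =>
        have := h (f (x ⊗ₜ y)) ((consEquiv K V k).symm t)
        rw [LinearEquiv.apply_symm_apply] at this
        simpa [conjHom, LinearEquiv.conj_apply, onFirstTwo] using this
    · simp only [MonoidHom.comp_apply]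
      rw [assocThree_second, opAt_succ, opAt_zero, conjHom_lTensor, conjHom_lTensor]
  | succ a ih =>
    obtain ⟨k, rfl⟩ : ∃ k, n = k + 1 := ⟨n - 1, by omega⟩
    obtain ⟨Θ, hΘ⟩ := ih k (by omega)
    refine ⟨(conjHom (consEquiv K V k)).comp ((lTensorHom V _).comp Θ), fun f => ⟨?_, ?_⟩⟩
    · simp [hΘ f, opAt_succ]
    · simp [hΘ f, opAt_succ]

end tensors

/-! ## Braided algebras -/

/-- A braided algebra `(V, σ, m)`: an associative, not necessarily unital, multiplication `m` on
`V` and a solution `σ` of the braid equation such that `m` commutes with the braiding. -/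
structure BraidedAlgebra (K V : Type*) [Field K] [AddCommGroup V] [Module K V] where
  σ : V ⊗[K] V →ₗ[K] V ⊗[K] V
  m : V ⊗[K] V →ₗ[K] V
  braid : onFirstTwo σ V * LinearMap.lTensor V σ * onFirstTwo σ V =
    LinearMap.lTensor V σ * onFirstTwo σ V * LinearMap.lTensor V σ
  mul_assoc : m ∘ₗ LinearMap.rTensor V m =
    m ∘ₗ LinearMap.lTensor V m ∘ₗ (TensorProduct.assoc K V V V).toLinearMap
  braid_mul_right : σ ∘ₗ LinearMap.lTensor V m =
    LinearMap.rTensor V m ∘ₗ (TensorProduct.assoc K V V V).symm.toLinearMap ∘ₗ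
      LinearMap.lTensor V σ ∘ₗ onFirstTwo σ V
  braid_mul_left : σ ∘ₗ LinearMap.rTensor V m ∘ₗ (TensorProduct.assoc K V V V).symm.toLinearMap =
    LinearMap.lTensor V m ∘ₗ onFirstTwo σ V ∘ₗ LinearMap.lTensor V σ

section braided

variable {K W : Type*} [Field K] [AddCommGroup W] [Module K W]

/-- `𝟏` is a two-sided unit for `m` and is braided with every vector by the flip. -/
structure IsBraidedUnit (B : BraidedAlgebra K W) (e : W) : Prop where
  one_mul : ∀ v, B.m (e ⊗ₜ v) = v
  mul_one : ∀ v, B.m (v ⊗ₜ e) = v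
  braid_one : ∀ v, B.σ (e ⊗ₜ v) = v ⊗ₜ e
  one_braid : ∀ v, B.σ (v ⊗ₜ e) = e ⊗ₜ v

/-- The map `σ^m : v ⊗ w ↦ 𝟏 ⊗ m (v ⊗ w)`. -/
def sigmaM (B : BraidedAlgebra K W) (e : W) : W ⊗[K] W →ₗ[K] W ⊗[K] W :=
  TensorProduct.mk K W W e ∘ₗ B.m

theorem sigmaM_first (B : BraidedAlgebra K W) (e : W) (t : W ⊗[K] (W ⊗[K] W)) :
    onFirstTwo (sigmaM B e) W t =
      e ⊗ₜ LinearMap.rTensor W B.m ((TensorProduct.assoc K W W W).symm t) := by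
  suffices h : onFirstTwo (sigmaM B e) W = TensorProduct.mk K W _ e ∘ₗ
      LinearMap.rTensor W B.m ∘ₗ (TensorProduct.assoc K W W W).symm.toLinearMap from
    LinearMap.congr_fun h t
  apply TensorProduct.ext_threefold'
  intro x y z
  simp [onFirstTwo, sigmaM]

theorem sigmaM_second (B : BraidedAlgebra K W) (e : W) (x : W) (u : W ⊗[K] W) :
    LinearMap.lTensor W (sigmaM B e) (x ⊗ₜ u) = x ⊗ₜ (e ⊗ₜ B.m u) := by
  simp [sigmaM]

theorem mixed_left (B : BraidedAlgebra K W) {e : W} (he : IsBraidedUnit B e) :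
    onFirstTwo (sigmaM B e) W * LinearMap.lTensor W B.σ * onFirstTwo B.σ W =
      LinearMap.lTensor W B.σ * onFirstTwo B.σ W * LinearMap.lTensor W (sigmaM B e) := by
  apply TensorProduct.ext'
  intro x u
  have h := LinearMap.congr_fun B.braid_mul_right (x ⊗ₜ u)
  simp only [LinearMap.comp_apply, LinearEquiv.coe_coe, LinearMap.lTensor_tmul] at h
  simp only [Module.End.mul_apply, sigmaM_first, sigmaM_second]
  rw [← h]
  simp [onFirstTwo, he.one_braid]

theorem mixed_right (B : BraidedAlgebra K W) {e : W} (he : IsBraidedUnit B e) :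
    LinearMap.lTensor W (sigmaM B e) * onFirstTwo B.σ W * LinearMap.lTensor W B.σ =
      onFirstTwo B.σ W * LinearMap.lTensor W B.σ * onFirstTwo (sigmaM B e) W := by
  refine LinearMap.ext fun t => ?_
  have h := LinearMap.congr_fun B.braid_mul_left t
  simp only [LinearMap.comp_apply, LinearEquiv.coe_coe] at h
  simp only [Module.End.mul_apply, sigmaM_first, LinearMap.lTensor_tmul]
  rw [h]
  generalize onFirstTwo B.σ W (LinearMap.lTensor W B.σ t) = s
  induction s with
  | zero => simp
  | add a b ha hb => simp only [TensorProduct.tmul_add, map_add, ha, hb]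
  | tmul x u =>
    rw [sigmaM_second]
    simp [onFirstTwo, he.braid_one]

theorem braid_sigmaM (B : BraidedAlgebra K W) {e : W} (he : IsBraidedUnit B e) :
    onFirstTwo (sigmaM B e) W * LinearMap.lTensor W (sigmaM B e) * onFirstTwo (sigmaM B e) W =
      LinearMap.lTensor W (sigmaM B e) * onFirstTwo (sigmaM B e) W *
        LinearMap.lTensor W (sigmaM B e) := by
  apply TensorProduct.ext'
  intro x u
  have h := LinearMap.congr_fun B.mul_assoc ((TensorProduct.assoc K W W W).symm (x ⊗ₜ u))
  simp only [LinearMap.comp_apply, LinearEquiv.coe_coe, LinearEquiv.apply_symm_apply,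
    LinearMap.lTensor_tmul] at h
  simp only [Module.End.mul_apply, sigmaM_first, sigmaM_second]
  simp only [TensorProduct.assoc_symm_tmul, LinearMap.rTensor_tmul, he.mul_one, h]

/-- The action of `GVB_n⁺` on `W^{⊗ n}`: `σ_i` acts as `σ` and `ξ_i` as `σ^m` on the factors
`i` and `i + 1`. -/
def gvbAction (B : BraidedAlgebra K W) {e : W} (he : IsBraidedUnit B e) (n : ℕ) :
    GVBMonoid n →* Module.End K (⨂[K]^n W) :=
  PresentedMonoid.lift
    (fun g => match g with
      | .sig a => opAt B.σ n a.val
      | .xi a => opAt (sigmaM B e) n a.val)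
    (by
      have hc : ∀ (f g : W ⊗[K] W →ₗ[K] W ⊗[K] W) (a b : Fin (n - 1)),
          a.val + 1 < b.val ∨ b.val + 1 < a.val →
          opAt f n a.val * opAt g n b.val = opAt g n b.val * opAt f n a.val := by
        rintro f g a b (h | h)
        · exact opAt_commute f g n _ _ h (by omega)
        · exact (opAt_commute g f n _ _ h (by omega)).symm
      intro x y h
      cases h <;> simp only [map_mul, FreeMonoid.lift_eval_of]
      case sig_sig a b h => exact hc _ _ a b h
      case sig_xi a b h => exact hc _ _ a b h
      case xi_xi a b h => exact hc _ _ a b h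
      all_goals
        rename_i a b h
        obtain ⟨Θ, hΘ⟩ := exists_opAt_three K W n a.val (by omega)
        simp only [h, ← (hΘ B.σ).1, ← (hΘ B.σ).2, ← (hΘ (sigmaM B e)).1,
          ← (hΘ (sigmaM B e)).2, ← map_mul, B.braid, mixed_left B he, mixed_right B he,
          braid_sigmaM B he])

/-- The representation of the algebra of `GVB_n⁺` on `W^{⊗ n}`. -/
def gvbRep (B : BraidedAlgebra K W) {e : W} (he : IsBraidedUnit B e) (n : ℕ) :
    MonoidAlgebra K (GVBMonoid n) →ₐ[K] Module.End K (⨂[K]^n W) :=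
  MonoidAlgebra.lift K _ _ (gvbAction B he n)

/-! ## The deleting operator -/

/-- The deleting operator `D : T(W) → T(V)`, where `W = K 𝟏 ⊕ V`: the algebra homomorphism that
sends `𝟏` to the empty word and is the identity on `V`.  On a pure tensor all of whose factors
are equal to `𝟏` or lie in `V` it deletes the factors `𝟏`. -/
def deleteOne {e : W} (hne : e ≠ 0) {V : Submodule K W} (hV : IsCompl (K ∙ e) V) :
    TensorAlgebra K W →ₐ[K] TensorAlgebra K V :=
  TensorAlgebra.lift K
    (Algebra.linearMap K (TensorAlgebra K V) ∘ₗ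
        (LinearEquiv.toSpanNonzeroSingleton K W e hne).symm.toLinearMap ∘ₗ
        Submodule.projectionOnto (K ∙ e) V hV +
      TensorAlgebra.ι K ∘ₗ Submodule.projectionOnto V (K ∙ e) hV.symm)

theorem deleteOne_one {e : W} (hne : e ≠ 0) {V : Submodule K W} (hV : IsCompl (K ∙ e) V) :
    deleteOne hne hV (TensorAlgebra.ι K e) = 1 := by
  have h1 : Submodule.projectionOnto (K ∙ e) V hV e = ⟨e, Submodule.mem_span_singleton_self e⟩ :=
    Submodule.projectionOnto_apply_left hV ⟨e, Submodule.mem_span_singleton_self e⟩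
  have h2 : Submodule.projectionOnto V (K ∙ e) hV.symm e = 0 :=
    Submodule.projectionOnto_apply_right hV.symm ⟨e, Submodule.mem_span_singleton_self e⟩
  have h3 : (LinearEquiv.toSpanNonzeroSingleton K W e hne).symm
      ⟨e, Submodule.mem_span_singleton_self e⟩ = 1 := by
    rw [LinearEquiv.symm_apply_eq]; ext; simp
  simp [deleteOne, h1, h2, h3]

theorem deleteOne_mem {e : W} (hne : e ≠ 0) {V : Submodule K W} (hV : IsCompl (K ∙ e) V)
    (v : V) : deleteOne hne hV (TensorAlgebra.ι K (v : W)) = TensorAlgebra.ι K v := by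
  have h1 : Submodule.projectionOnto (K ∙ e) V hV v = 0 :=
    Submodule.projectionOnto_apply_right hV v
  have h2 : Submodule.projectionOnto V (K ∙ e) hV.symm v = v :=
    Submodule.projectionOnto_apply_left hV.symm v
  simp [deleteOne, h1, h2]

end braided

/-! ## The quantum quasi-shuffle product -/

section quasiShuffle

variable {K V : Type*} [Field K] [AddCommGroup V] [Module K V]

/-- `v ⊗ x ↦ v · f(x)`, the first factor being multiplied by concatenation. -/
def consWith {n : ℕ} (f : (⨂[K]^n V) →ₗ[K] TensorAlgebra K V) :
    (⨂[K]^(n + 1) V) →ₗ[K] TensorAlgebra K V :=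
  LinearMap.mul' K (TensorAlgebra K V) ∘ₗ TensorProduct.map (TensorAlgebra.ι K) f ∘ₗ
    (consEquiv K V n).symm.toLinearMap

/-- `m ⊗ id : V^{⊗ (n + 2)} → V^{⊗ (n + 1)}`. -/
def mulFirst (A : BraidedAlgebra K V) (n : ℕ) : (⨂[K]^(n + 2) V) →ₗ[K] (⨂[K]^(n + 1) V) :=
  (consEquiv K V n).toLinearMap ∘ₗ LinearMap.rTensor (⨂[K]^n V) A.m ∘ₗ
    (TensorProduct.assoc K V V (⨂[K]^n V)).symm.toLinearMap ∘ₗ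
    (LinearEquiv.lTensor V (consEquiv K V n)).symm.toLinearMap ∘ₗ
    (consEquiv K V (n + 1)).symm.toLinearMap

/-- The quantum quasi-shuffle product of the first `p` and the last `n - p` factors of a tensor in
`V^{⊗ n}`.  If one of the words is empty it is the concatenation; otherwise, for words `u x` and
`v y` with first letters `u` and `v`, it is the sum of
* `u · (x ∗ (v y))`,
* `v' · ((u x)' ∗ y)`, where `v' ⊗ (u x)'` is obtained by braiding `u x` with `v`,
* `m(u ⊗ v') · (x' ∗ y)`, where `v' ⊗ x'` is obtained by braiding `x` with `v`. -/
def quasiShuffle (A : BraidedAlgebra K V) : (n p : ℕ) → (⨂[K]^n V) →ₗ[K] TensorAlgebra K V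
  | 0, _ => TensorPower.toTensorAlgebra
  | 1, _ => TensorPower.toTensorAlgebra
  | _ + 2, 0 => TensorPower.toTensorAlgebra
  | n + 2, p + 1 =>
    if n + 2 ≤ p + 1 then TensorPower.toTensorAlgebra
    else
      consWith (quasiShuffle A (n + 1) p) +
      consWith (quasiShuffle A (n + 1) (p + 1)) ∘ₗ runProd (opAt A.σ (n + 2)) 0 p +
      consWith (quasiShuffle A n p) ∘ₗ mulFirst A n ∘ₗ runProd (opAt A.σ (n + 2)) 1 p

/-- The quantum quasi-shuffle product on `V^{⊗ p} × V^{⊗ q}`. -/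
def quasiShufflePow (A : BraidedAlgebra K V) (p q : ℕ) :
    (⨂[K]^p V) →ₗ[K] (⨂[K]^q V) →ₗ[K] TensorAlgebra K V :=
  TensorProduct.curry (quasiShuffle A (p + q) p ∘ₗ TensorPower.mulEquiv.toLinearMap)

/-- The quantum quasi-shuffle product `∗` on `T(V)`, the bilinear extension of its restrictions to
`V^{⊗ p} × V^{⊗ q}`. -/
def qstar (A : BraidedAlgebra K V) :
    TensorAlgebra K V →ₗ[K] TensorAlgebra K V →ₗ[K] TensorAlgebra K V :=
  DirectSum.toModule K ℕ _ (fun p => LinearMap.flip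
      (DirectSum.toModule K ℕ _ (fun q => (quasiShufflePow A p q).flip) ∘ₗ
        (TensorAlgebra.equivDirectSum (R := K) (M := V)).toLinearMap)) ∘ₗ
    (TensorAlgebra.equivDirectSum (R := K) (M := V)).toLinearMap

end quasiShuffle

end GMT

end

namespace GMT

/-! ## Shuffles and their bubble decompositions -/

/-! Let S(k, p, q), for k + p + q = n, be the sum of the lifts of all (p, q)-shuffles of the last p
+ q positions (`shuffleSum`). The combinatorial core is the three-term recursion `shuffleSum_rec`,
which mirrors the recursion defining ∗. A shuffle with two nonempty blocks either leaves the first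
letter of the left block in front or brings the first letter of the right block there
(`IsShuffle.first`). In the second case it is w c, where c is a cycle s_{k+1} s_{k+2} ⋯ and w is a
shuffle starting one position later. The bubble decomposition of w c is that of w with the factor c
appended on the right. The lift of c is a run of σ's, together with a term containing one ξ exactly
when w fixes its own first position, that is, when w is a shuffle starting two positions later
(`IsShuffle.lift_mul_cycle`).

On words the three terms say: keep u in front; braid v to the front; braid v up to u and multiply.
In the last case ξ leaves a 𝟏 next to the product, and the run σ_1 ⋯ σ_k to the left of ξ carries
this 𝟏 to the very front of the word. Thus the virtual length counts the 𝟏's accumulated at the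
front, and D removes them.

For three words, w ↦ (w'_L, w'_R) turns the sum over descent classes into a double sum. Since M'(w,
τ) sees τ only through l = l_v(τ) and the final factor τ, summing over w'_L gives the linear map τ ↦
S(l, i, n - i - l) τ (`twist`, `sum_liftTwo`). After the inner shuffles there are l letters 𝟏 in
front, so the outer shuffles must start at position l + 1, which is what the shift in M' achieves.

The analytic core is `delete_twist_shuffleSum`, an induction on the length of the word still to be
shuffled. It keeps track of the r leading 𝟏's, a spectator word G, and the letters y already
produced, and it allows a later operator F(l) depending on the virtual length. It is used twice.
With F = 1 and G empty it says that S computes ∗ of two words, also behind a prefix of 𝟏's. This is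
the hypothesis on F for the second use, where G is the first word, F(l) = S(l, i, n - i - l), and Ψ
is left ∗-multiplication by the first word. -/

theorem IsShuffle.lt_of_lt {n k p q : ℕ} {w : Equiv.Perm (Fin n)} (hw : IsShuffle k p q w)
    (a b : Fin n) (hab : a < b) (hb : b.val < k + p) : w a < w b := by
  have hfix : ∀ c : Fin n, c.val < k → w c = c := fun c hc => hw.fixed c (Or.inl hc)
  rcases lt_or_ge a.val k with ha | ha
  · rcases lt_or_ge b.val k with hb' | hb'
    · rwa [hfix a ha, hfix b hb']
    · have := le_of_fixed k w hfix b hb'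
      rw [hfix a ha, Fin.lt_def]
      omega
  · exact hw.left a b ha hab hb

theorem isShuffle_one (n k p q : ℕ) : IsShuffle k p q (1 : Equiv.Perm (Fin n)) :=
  ⟨fun _ _ => rfl, fun _ _ _ h _ => h, fun _ _ _ h _ => h⟩

theorem perm_eq_one_of_strictMono {n : ℕ} (w : Equiv.Perm (Fin n))
    (h : ∀ a b : Fin n, a < b → w a < w b) : w = 1 := by
  have hs : StrictMono w := fun a b hab => h a b hab
  -- A finite chain has only one order automorphism.
  have := Subsingleton.elim (hs.orderIsoOfSurjective w w.surjective) (OrderIso.refl (Fin n))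
  ext a
  exact congrArg Fin.val (DFunLike.congr_fun this a)

theorem IsShuffle.eq_one {n k p q : ℕ} {w : Equiv.Perm (Fin n)} (hw : IsShuffle k p q w)
    (hpq : p = 0 ∨ q = 0) : w = 1 := by
  apply perm_eq_one_of_strictMono
  intro a b hab
  have hfix : ∀ c : Fin n, c.val < k → w c = c := fun c hc => hw.fixed c (Or.inl hc)
  have htail : ∀ c : Fin n, k + p + q ≤ c.val → w c = c := fun c hc => hw.fixed c (Or.inr hc)
  have hlow : ∀ c : Fin n, c.val < k + p + q → (w c).val < k + p + q := by
    intro c hc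
    by_contra h
    have := w.injective (htail (w c) (by omega))
    rw [this] at h
    omega
  rcases lt_or_ge b.val (k + p + q) with hb | hb
  · rcases hpq with rfl | rfl
    · rcases lt_or_ge a.val k with ha | ha
      · rcases lt_or_ge b.val k with hb' | hb'
        · exact hw.lt_of_lt a b hab (by omega)
        · have := le_of_fixed k w hfix b hb'
          rw [hfix a ha, Fin.lt_def]
          omega
      · exact hw.right a b (by omega) hab (by omega)
    · exact hw.lt_of_lt a b hab (by omega)
  · rw [htail b hb]
    rcases lt_or_ge a.val (k + p + q) with ha | ha
    · exact Fin.lt_def.mpr ((hlow a ha).trans_le hb)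
    · rwa [htail a ha]

/-- Some letter of one of the blocks must arrive at the first free position. As both blocks stay in
increasing order, that letter is the first of its block. -/
theorem IsShuffle.first {n k p q : ℕ} {w : Equiv.Perm (Fin n)} (hw : IsShuffle k p q w)
    (hn : k + p + q = n) (hp : 0 < p) (hq : 0 < q) :
    w ⟨k, by omega⟩ = ⟨k, by omega⟩ ∨ w ⟨k + p, by omega⟩ = ⟨k, by omega⟩ := by
  have hfix : ∀ c : Fin n, c.val < k → w c = c := fun c hc => hw.fixed c (Or.inl hc)
  obtain ⟨c, hc⟩ := w.surjective ⟨k, by omega⟩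
  have hck : k ≤ c.val := by
    by_contra h
    rw [hfix c (by omega)] at hc
    rw [hc] at h
    exact h le_rfl
  rcases lt_or_ge c.val (k + p) with h | h
  · left
    rcases hck.eq_or_lt with h' | h'
    · have : c = ⟨k, by omega⟩ := Fin.ext h'.symm
      rw [← this, hc, this]
    · have h1 := hw.left ⟨k, by omega⟩ c le_rfl h' h
      have h2 := le_of_fixed k w hfix ⟨k, by omega⟩ le_rfl
      rw [hc, Fin.lt_def] at h1
      simp only at h1
      omega
  · right
    rcases h.eq_or_lt with h' | h'
    · have : c = ⟨k + p, by omega⟩ := Fin.ext h'.symm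
      rw [← this, hc]
    · have h1 := hw.right ⟨k + p, by omega⟩ c le_rfl h' (by omega)
      have h2 := le_of_fixed k w hfix ⟨k + p, by omega⟩ (by simp)
      rw [hc, Fin.lt_def] at h1
      simp only at h1
      omega

/-- A first letter that does not move can be counted among the fixed positions instead of the left
block. Used for the first term of the recursion and, one step later, for the term containing ξ. -/
theorem isShuffle_succ_iff {n k p q : ℕ} (w : Equiv.Perm (Fin n)) (hk : k < n) :
    IsShuffle (k + 1) p q w ↔ IsShuffle k (p + 1) q w ∧ w ⟨k, hk⟩ = ⟨k, hk⟩ := by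
  constructor
  · intro hw
    refine ⟨⟨fun a ha => hw.fixed a (by omega), fun a b _ hab hb => ?_,
      fun a b ha hab hb => hw.right a b (by omega) hab (by omega)⟩, hw.fixed _ (by simp)⟩
    exact hw.lt_of_lt a b hab (by omega)
  · rintro ⟨hw, hwk⟩
    refine ⟨fun a ha => ?_, fun a b ha hab hb => hw.left a b (by omega) hab (by omega),
      fun a b ha hab hb => hw.right a b (by omega) hab (by omega)⟩
    by_cases h : a.val = k
    · have : a = ⟨k, hk⟩ := Fin.ext h
      rw [this, hwk]
    · exact hw.fixed a (by omega)

/-- Composition with the cycle that moves the position `k + p` to the position `k`. -/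
theorem isShuffle_mul_cycle_iff {n k p q : ℕ} (hn : k + p + (q + 1) = n) (w : Equiv.Perm (Fin n)) :
    IsShuffle (k + 1) p q w ↔
      IsShuffle k p (q + 1) (w * runProd (simpleTransp n) (k + 1) (k + p)) ∧
        (w * runProd (simpleTransp n) (k + 1) (k + p)) ⟨k + p, by omega⟩ = ⟨k, by omega⟩ := by
  set c := runProd (simpleTransp n) (k + 1) (k + p) with hc
  have hcv : ∀ x : Fin n, (c x).val =
      if x.val = k + p then k else if k ≤ x.val ∧ x.val < k + p then x.val + 1 else x.val := by
    intro x
    rw [hc, runProd_simpleTransp_apply (by omega) (by omega) (by omega)]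
    simp
  have hmul : ∀ x y : Fin n, (c x).val = y.val → (w * c) x = w y := by
    intro x y h
    rw [Equiv.Perm.mul_apply, Fin.ext h]
  constructor
  · intro hw
    have hfix : ∀ b : Fin n, b.val < k + 1 → w b = b := fun b hb => hw.fixed b (Or.inl hb)
    have hlast : (w * c) ⟨k + p, by omega⟩ = ⟨k, by omega⟩ := by
      rw [hmul _ ⟨k, by omega⟩ (by rw [hcv]; simp)]
      exact hfix _ (by simp)
    refine ⟨⟨fun a ha => ?_, fun a b ha hab hb => ?_, fun a b ha hab hb => ?_⟩, hlast⟩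
    · rw [hmul a a (by rw [hcv]; split_ifs <;> omega)]
      exact hfix a (by omega)
    · rw [hmul a ⟨a.val + 1, by omega⟩ (by rw [hcv]; simp only; split_ifs <;> omega),
        hmul b ⟨b.val + 1, by omega⟩ (by rw [hcv]; simp only; split_ifs <;> omega)]
      exact hw.left _ _ (by simp; omega) (Fin.lt_def.mpr (by simp only; omega)) (by simp; omega)
    · have hb' : (w * c) b = w b := hmul b b (by rw [hcv]; split_ifs <;> omega)
      by_cases h : a.val = k + p
      · have : a = ⟨k + p, by omega⟩ := Fin.ext h
        rw [this, hlast, hb', Fin.lt_def]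
        exact le_of_fixed (k + 1) w hfix b (by omega)
      · rw [hb', hmul a a (by rw [hcv]; split_ifs <;> omega)]
        exact hw.right a b (by omega) hab (by omega)
  · rintro ⟨hw, hlast⟩
    refine ⟨fun a ha => ?_, fun a b ha hab hb => ?_, fun a b ha hab hb => ?_⟩
    · by_cases h : a.val = k
      · rw [← hmul ⟨k + p, by omega⟩ a (by rw [hcv]; simp [h]), hlast]
        exact Fin.ext h.symm
      · rw [← hmul a a (by rw [hcv]; split_ifs <;> omega)]
        exact hw.fixed a (by omega)
    · rw [← hmul ⟨a.val - 1, by omega⟩ a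
          (by rw [hcv]; simp only; split_ifs <;> omega),
        ← hmul ⟨b.val - 1, by omega⟩ b (by rw [hcv]; simp only; split_ifs <;> omega)]
      exact hw.left _ _ (by simp; omega) (by simp [Fin.lt_def]; omega) (by simp; omega)
    · rw [← hmul a a (by rw [hcv]; split_ifs <;> omega),
        ← hmul b b (by rw [hcv]; split_ifs <;> omega)]
      exact hw.right a b (by omega) hab (by omega)

/-! ### Bubble indices of shuffles -/

theorem bubbleIndex_eq_zero {n : ℕ} (w : Equiv.Perm (Fin n)) (m : ℕ)
    (h : ∀ a b : Fin n, b.val = m → a < b → w a < w b) : bubbleIndex w m = 0 := by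
  unfold bubbleIndex
  split_ifs with hm
  · have : (Finset.univ.filter fun a : Fin n => a.val ≤ m ∧ w a ≤ w ⟨m, hm⟩) =
        Finset.Iic ⟨m, hm⟩ := by
      ext a
      simp only [Finset.mem_filter, Finset.mem_univ, true_and, Finset.mem_Iic, Fin.le_def]
      refine ⟨fun h => h.1, fun ha => ⟨ha, ?_⟩⟩
      rcases ha.eq_or_lt with h' | h'
      · rw [show a = ⟨m, hm⟩ from Fin.ext h']
      · exact (h a ⟨m, hm⟩ rfl h').le
    simp [this]
  · rfl

theorem IsShuffle.bubbleIndex_eq_zero {n k p q : ℕ} {w : Equiv.Perm (Fin n)}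
    (hw : IsShuffle k p q w) (m : ℕ) (hm : m < k + p) : bubbleIndex w m = 0 :=
  GMT.bubbleIndex_eq_zero w m fun a b hb hab => hw.lt_of_lt a b hab (by omega)

/-- The index records only the rank of one letter among those at positions up to `m`. Precomposing
with a permutation of these positions that fixes the last one does not change this rank. -/
theorem bubbleIndex_mul {n : ℕ} (w c : Equiv.Perm (Fin n)) (m : ℕ)
    (hc : ∀ a : Fin n, (c a).val ≤ m ↔ a.val ≤ m) (hm : ∀ a : Fin n, a.val = m → c a = a) :
    bubbleIndex (w * c) m = bubbleIndex w m := by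
  unfold bubbleIndex
  split_ifs with h
  · have : (Finset.univ.filter fun a : Fin n => a.val ≤ m ∧ (w * c) a ≤ (w * c) ⟨m, h⟩).card =
        (Finset.univ.filter fun a : Fin n => a.val ≤ m ∧ w a ≤ w ⟨m, h⟩).card := by
      refine Finset.card_equiv c fun a => ?_
      simp only [Finset.mem_filter, Finset.mem_univ, true_and, Equiv.Perm.mul_apply, hc,
        hm ⟨m, h⟩ rfl]
    simp only [this]
  · rfl

/-- The letters that end up no later than this one are itself and the `k` fixed ones, so its rank is
`k + 1`. -/
theorem IsShuffle.bubbleIndex_eq {n k p q : ℕ} {w : Equiv.Perm (Fin n)} (hw : IsShuffle k p q w)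
    (hn : k + p < n) (hp : 0 < p) (h : w ⟨k + p, hn⟩ = ⟨k, by omega⟩) :
    bubbleIndex w (k + p) = k + 1 := by
  have hfix : ∀ c : Fin n, c.val < k → w c = c := fun c hc => hw.fixed c (Or.inl hc)
  have hcard : (Finset.univ.filter fun a : Fin n => a.val ≤ k + p ∧ w a ≤ w ⟨k + p, hn⟩).card =
      k + 1 := by
    rw [show k + 1 = (Finset.Iic (⟨k, by omega⟩ : Fin n)).card by simp]
    refine Finset.card_equiv w fun a => ?_
    simp only [Finset.mem_filter, Finset.mem_univ, true_and, h, Finset.mem_Iic,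
      and_iff_right_iff_imp]
    intro ha
    rcases ha.lt_or_eq with ha | ha
    · by_contra h'
      have := le_of_fixed k w hfix a (by omega)
      rw [Fin.lt_def] at ha
      simp only at ha
      omega
    · rw [← h] at ha
      simp [w.injective ha]
  simp only [bubbleIndex, hn, dif_pos, hcard]
  -- Here `0 < p` matters: for `p = 0` the rank would be the maximal one, which `bubbleIndex`
  -- replaces by 0.
  rw [if_pos (by omega)]

/-- Now `k + 1` letters are fixed in front, so the rank of the first right letter is at least `k +
2`. The index is that rank or the default 0. -/
theorem IsShuffle.bubbleIndex_ne {n k p q : ℕ} {w : Equiv.Perm (Fin n)} (hw : IsShuffle k p q w)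
    (hn : k + p < n) (hp : 0 < p) (h : w ⟨k, by omega⟩ = ⟨k, by omega⟩) :
    bubbleIndex w (k + p) ≠ k + 1 := by
  have hfix : ∀ c : Fin n, c.val < k + 1 → w c = c := by
    intro c hc
    by_cases h' : c.val = k
    · rw [show c = ⟨k, by omega⟩ from Fin.ext h', h]
    · exact hw.fixed c (by omega)
  have hge := le_of_fixed (k + 1) w hfix ⟨k + p, hn⟩ (by simp; omega)
  have hcard : k + 2 ≤
      (Finset.univ.filter fun a : Fin n => a.val ≤ k + p ∧ w a ≤ w ⟨k + p, hn⟩).card := by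
    have : (insert ⟨k + p, hn⟩ (Finset.Iic (⟨k, by omega⟩ : Fin n))).card = k + 2 := by
      rw [Finset.card_insert_of_notMem (by simp [Fin.le_def]; omega)]
      simp
    rw [← this]
    apply Finset.card_le_card
    intro a ha
    simp only [Finset.mem_insert, Finset.mem_Iic] at ha
    simp only [Finset.mem_filter, Finset.mem_univ, true_and]
    rcases ha with rfl | ha
    · simp
    · have ha' : a.val ≤ k := ha
      refine ⟨by omega, ?_⟩
      rw [hfix a (by omega), Fin.le_def]
      omega
  simp only [bubbleIndex, hn, dif_pos]
  split_ifs <;> omega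

/-! ### Descending products -/

theorem descProd_succ {M : Type*} [Monoid M] (g : ℕ → M) (n : ℕ) (hn : 1 ≤ n) :
    descProd g (n + 1) = g n * descProd g n := by
  obtain ⟨m, rfl⟩ : ∃ m, n = m + 1 := ⟨n - 1, by omega⟩
  simp only [descProd, Nat.add_sub_cancel]
  rw [List.range'_concat]
  simp [add_comm]

theorem descProd_eq_one {M : Type*} [Monoid M] (g : ℕ → M) (n : ℕ)
    (h : ∀ m, m < n → g m = 1) : descProd g n = 1 := by
  apply List.prod_eq_one
  intro x hx
  simp only [List.mem_map, List.mem_reverse, List.mem_range'_1] at hx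
  obtain ⟨a, ha, rfl⟩ := hx
  exact h a (by omega)

theorem descProd_eq_mul {M : Type*} [Monoid M] (g g' : ℕ → M) (n m : ℕ) (hm : 1 ≤ m)
    (hmn : m < n) (h1 : ∀ a, a < m → g a = 1) (h2 : ∀ a, a ≤ m → g' a = 1)
    (h3 : ∀ a, m < a → g a = g' a) : descProd g n = descProd g' n * g m := by
  induction n with
  | zero => omega
  | succ n ih =>
    rw [descProd_succ g n (by omega), descProd_succ g' n (by omega)]
    rcases Nat.lt_succ_iff_lt_or_eq.mp hmn with h | rfl
    · rw [ih h, h3 n h, mul_assoc]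
    · rw [descProd_eq_one g m h1, h2 m le_rfl, descProd_eq_one g' m fun a ha => h2 a ha.le]
      simp

/-! ## The sum of the lifts of all shuffles -/

section sums

variable (K : Type*) [Field K]

theorem liftFactor_eq_one {n : ℕ} (w : Equiv.Perm (Fin n)) (m : ℕ) (h : bubbleIndex w m = 0) :
    liftFactor K w m = 1 := by
  simp [liftFactor, h]

/-- The cycle contributes the bubble factor with index `k + p`. Below it all factors are trivial for
both permutations, and above it they agree because the cycle only permutes positions up to `k + p`
(0-based). The Kronecker delta in the new factor asks whether the next index is `k + 2`; by
`IsShuffle.first` this happens exactly when `w` does not fix its first active position. -/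
theorem IsShuffle.lift_mul_cycle {n k p q : ℕ} (hn : k + p + (q + 1) = n) (hp : 0 < p)
    {w : Equiv.Perm (Fin n)} (hw : IsShuffle (k + 1) p q w) :
    descProd (liftFactor K (w * runProd (simpleTransp n) (k + 1) (k + p))) n =
      descProd (liftFactor K w) n *
        ((sigAlg K n (k + 1) + if w ⟨k + 1, by omega⟩ = ⟨k + 1, by omega⟩ then
          runProd (sigAlg K n) 1 k * xiAlg K n (k + 1) else 0) *
          runProd (sigAlg K n) (k + 2) (k + p)) := by
  obtain ⟨hw', hlast⟩ := (isShuffle_mul_cycle_iff hn w).mp hw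
  set c := runProd (simpleTransp n) (k + 1) (k + p) with hc
  have hcv : ∀ x : Fin n, (c x).val =
      if x.val = k + p then k else if k ≤ x.val ∧ x.val < k + p then x.val + 1 else x.val := by
    intro x
    rw [hc, runProd_simpleTransp_apply (by omega) (by omega) (by omega)]
    simp
  have hidx : ∀ m, k + p < m → bubbleIndex (w * c) m = bubbleIndex w m := by
    intro m hm
    apply bubbleIndex_mul
    · intro a
      rw [hcv]
      split_ifs <;> omega
    · intro a ha
      apply Fin.ext
      rw [hcv]
      split_ifs <;> omega
  rw [descProd_eq_mul (liftFactor K (w * c)) (liftFactor K w) n (k + p) (by omega) (by omega)]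
  · congr 1
    have h1 := hw'.bubbleIndex_eq (by omega) hp hlast
    simp only [liftFactor, h1]
    rw [if_neg (by omega), hidx _ (by omega), Nat.add_sub_cancel]
    congr 2
    have hiff : k + 1 + 1 = bubbleIndex w (k + p + 1) ↔
        ¬ w ⟨k + 1, by omega⟩ = ⟨k + 1, by omega⟩ := by
      rw [show k + p + 1 = k + 1 + p by omega]
      -- For an empty right block `k + 1 + p = n`, so the next index is the convention `t_n = 0`.
      -- Then `w` is the identity, and the ξ-term is present, as required.
      rcases Nat.eq_zero_or_pos q with rfl | hq
      · have h2 : bubbleIndex w (k + 1 + p) = 0 := by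
          simp only [bubbleIndex]
          rw [dif_neg (by omega)]
        simp [h2, DFunLike.congr_fun (hw.eq_one (Or.inr rfl)) _]
      · constructor
        · intro h h'
          exact hw.bubbleIndex_ne (by omega) hp h' h.symm
        · intro h
          exact (hw.bubbleIndex_eq (by omega) hp
            ((hw.first (by omega) hp hq).resolve_left h)).symm
    simp only [hiff, ite_not]
  · intro a ha
    exact liftFactor_eq_one K _ _ (hw'.bubbleIndex_eq_zero a ha)
  · intro a ha
    exact liftFactor_eq_one K _ _ (hw.bubbleIndex_eq_zero a (by omega))
  · intro a ha
    simp only [liftFactor, hidx a ha, hidx (a + 1) (by omega)]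

/-- The sum of the lifts of all `(p, q)`-shuffles of the positions `k + 1, …, k + p + q`. -/
noncomputable def shuffleSum (n k p q : ℕ) : MonoidAlgebra K (GVBMonoid n) :=
  ∑ w : Equiv.Perm (Fin n), liftShuffle K k p q w

theorem shuffleSum_eq_one (n k p q : ℕ) (hpq : p = 0 ∨ q = 0) : shuffleSum K n k p q = 1 := by
  rw [shuffleSum, Finset.sum_eq_single 1]
  · rw [liftShuffle, if_pos (isShuffle_one n k p q)]
    apply descProd_eq_one
    intro m _
    exact liftFactor_eq_one K _ _ (bubbleIndex_eq_zero _ _ fun _ _ _ h => h)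
  · intro w _ hw
    exact if_neg fun h => hw (h.eq_one hpq)
  · simp

/-- The lift of `w` depends on the block sizes only through the condition that `w` be a shuffle.
Hence shuffles fixing their first position contribute the first summand unchanged, and the others
are reindexed by right multiplication with the cycle. -/
theorem shuffleSum_rec (n k p q : ℕ) (hn : k + (p + 1) + (q + 1) = n) :
    shuffleSum K n k (p + 1) (q + 1) =
      shuffleSum K n (k + 1) p (q + 1) +
      shuffleSum K n (k + 1) (p + 1) q * runProd (sigAlg K n) (k + 1) (k + (p + 1)) +
      shuffleSum K n (k + 2) p q * (runProd (sigAlg K n) 1 k * xiAlg K n (k + 1) *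
        runProd (sigAlg K n) (k + 2) (k + (p + 1))) := by
  classical
  set c := runProd (simpleTransp n) (k + 1) (k + (p + 1)) with hc
  set S := runProd (sigAlg K n) (k + 2) (k + (p + 1)) with hS
  have hk : k < n := by omega
  -- `φ` is the contribution of the shuffles that bring the first right letter to the front,
  -- extended by zero so that its sum runs over the whole group and can be translated by `c`.
  obtain ⟨φ, hφ⟩ : ∃ φ : Equiv.Perm (Fin n) → MonoidAlgebra K (GVBMonoid n), ∀ w, φ w =
      if IsShuffle k (p + 1) (q + 1) w ∧ w ⟨k + (p + 1), by omega⟩ = ⟨k, hk⟩ then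
        descProd (liftFactor K w) n else 0 := ⟨_, fun _ => rfl⟩
  have h1 : ∀ w : Equiv.Perm (Fin n), liftShuffle K k (p + 1) (q + 1) w =
      liftShuffle K (k + 1) p (q + 1) w + φ w := by
    intro w
    simp only [liftShuffle, isShuffle_succ_iff w hk, hφ]
    by_cases hw : IsShuffle k (p + 1) (q + 1) w
    · by_cases h : w ⟨k, hk⟩ = ⟨k, hk⟩
      · have : w ⟨k + (p + 1), by omega⟩ ≠ ⟨k, hk⟩ := fun h' => by
          have := congrArg Fin.val (w.injective (h.trans h'.symm))
          simp at this
        simp [hw, h, this]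
      · have := (hw.first hn (by omega) (by omega)).resolve_left h
        simp [hw, h, this]
    · simp [hw]
  have h2 : ∀ w : Equiv.Perm (Fin n), φ (w * c) =
      liftShuffle K (k + 1) (p + 1) q w * (sigAlg K n (k + 1) * S) +
      liftShuffle K (k + 2) p q w *
        (runProd (sigAlg K n) 1 k * xiAlg K n (k + 1) * S) := by
    intro w
    have hiff := isShuffle_mul_cycle_iff hn w
    rw [← hc] at hiff
    rw [hφ, if_congr hiff.symm rfl rfl]
    simp only [liftShuffle, isShuffle_succ_iff (k := k + 1) w (by omega)]
    by_cases hw : IsShuffle (k + 1) (p + 1) q w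
    · simp only [hw, if_true, true_and]
      rw [hc, hw.lift_mul_cycle K hn (by omega), ← hS]
      split_ifs
      · rw [add_mul, mul_add]
      · simp
    · simp [hw]
  have h3 := (Equiv.sum_comp (Equiv.mulRight c) φ).symm
  simp only [Equiv.coe_mulRight, h2] at h3
  simp only [shuffleSum]
  rw [Finset.sum_congr rfl fun w _ => h1 w, Finset.sum_add_distrib, h3, Finset.sum_add_distrib,
    ← Finset.sum_mul, ← Finset.sum_mul, runProd_eq_mul _ (k + 1) _ (by omega), ← hS, add_assoc]

end sums

/-! ## Operators on the tensor algebra -/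

section tensorAlgebra

variable {K V : Type*} [Field K] [AddCommGroup V] [Module K V]

theorem equivDirectSum_toTensorAlgebra (n : ℕ) (x : ⨂[K]^n V) :
    TensorAlgebra.equivDirectSum (R := K) (M := V) (TensorPower.toTensorAlgebra x) =
      DirectSum.lof K ℕ (fun n => ⨂[K]^n V) n x := by
  have h : TensorAlgebra.ofDirectSum (DirectSum.of (fun n => ⨂[K]^n V) n x) =
      TensorPower.toTensorAlgebra x := by
    exact DirectSum.toAddMonoid_of
      (fun _ => LinearMap.toAddMonoidHom TensorPower.toTensorAlgebra) _ _
  rw [← h, TensorAlgebra.equivDirectSum_apply, TensorAlgebra.toDirectSum_ofDirectSum,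
    DirectSum.lof_eq_of]

theorem tensorAlgebra_linearMap_ext {M : Type*} [AddCommGroup M] [Module K M]
    {f g : TensorAlgebra K V →ₗ[K] M}
    (h : ∀ (n : ℕ) (x : ⨂[K]^n V), f (TensorPower.toTensorAlgebra x) =
      g (TensorPower.toTensorAlgebra x)) : f = g := by
  have : f ∘ₗ (TensorAlgebra.equivDirectSum (R := K) (M := V)).symm.toLinearMap =
      g ∘ₗ (TensorAlgebra.equivDirectSum (R := K) (M := V)).symm.toLinearMap := by
    apply DirectSum.linearMap_ext
    intro n
    ext1
    ext x
    have := h n (PiTensorProduct.tprod K x)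
    rw [← AlgEquiv.symm_apply_apply (TensorAlgebra.equivDirectSum (R := K) (M := V))
      (TensorPower.toTensorAlgebra (PiTensorProduct.tprod K x)),
      equivDirectSum_toTensorAlgebra] at this
    simpa using this
  ext1 x
  simpa using LinearMap.congr_fun this (TensorAlgebra.equivDirectSum x)

theorem toTensorAlgebra_consEquiv (n : ℕ) (v : V) (x : ⨂[K]^n V) :
    TensorPower.toTensorAlgebra (consEquiv K V n (v ⊗ₜ x)) =
      TensorAlgebra.ι K v * TensorPower.toTensorAlgebra x := by
  have : (TensorPower.toTensorAlgebra ∘ₗ (consEquiv K V n).toLinearMap ∘ₗ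
      TensorProduct.mk K V _ v : (⨂[K]^n V) →ₗ[K] TensorAlgebra K V) =
      LinearMap.mulLeft K (TensorAlgebra.ι K v) ∘ₗ TensorPower.toTensorAlgebra := by
    ext x
    simp [consEquiv_tprod, TensorAlgebra.tprod_apply, List.ofFn_succ]
  exact LinearMap.congr_fun this x

theorem tensorPower_linearMap_ext {M : Type*} [AddCommGroup M] [Module K M] {n : ℕ}
    {f g : (⨂[K]^(n + 1) V) →ₗ[K] M}
    (h : ∀ v x, f (consEquiv K V n (v ⊗ₜ x)) = g (consEquiv K V n (v ⊗ₜ x))) : f = g := by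
  have : f ∘ₗ (consEquiv K V n).toLinearMap = g ∘ₗ (consEquiv K V n).toLinearMap :=
    TensorProduct.ext' fun v x => by simpa using h v x
  ext1
  ext x
  have h2 := LinearMap.congr_fun this ((consEquiv K V n).symm (PiTensorProduct.tprod K x))
  simpa using h2

/-! ### Homogeneous components of the tensor algebra -/

variable (K V) in
/-- The homogeneous elements of degree `n` of the tensor algebra. -/
noncomputable def homog (n : ℕ) : Submodule K (TensorAlgebra K V) :=
  LinearMap.range (TensorPower.toTensorAlgebra : (⨂[K]^n V) →ₗ[K] TensorAlgebra K V)

theorem toTensorAlgebra_mem_homog {n : ℕ} (x : ⨂[K]^n V) :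
    TensorPower.toTensorAlgebra x ∈ homog K V n := ⟨x, rfl⟩

theorem one_mem_homog : (1 : TensorAlgebra K V) ∈ homog K V 0 :=
  ⟨_, TensorPower.toTensorAlgebra_gOne⟩

theorem ι_mem_homog (v : V) : TensorAlgebra.ι K v ∈ homog K V 1 :=
  ⟨PiTensorProduct.tprod K fun _ => v, by simp [TensorAlgebra.tprod_apply]⟩

theorem mul_mem_homog {m n : ℕ} {x y : TensorAlgebra K V} (hx : x ∈ homog K V m)
    (hy : y ∈ homog K V n) : x * y ∈ homog K V (m + n) := by
  obtain ⟨x, rfl⟩ := hx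
  obtain ⟨y, rfl⟩ := hy
  exact ⟨_, TensorPower.toTensorAlgebra_gMul x y⟩

theorem pow_mem_homog (v : V) (n : ℕ) : TensorAlgebra.ι K v ^ n ∈ homog K V n := by
  induction n with
  | zero => simpa using one_mem_homog
  | succ n ih => rw [pow_succ]; exact mul_mem_homog ih (ι_mem_homog v)

/-- Linear maps that agree on words of length `n` agree on `homog n`. -/
theorem homog_induction {M : Type*} [AddCommGroup M] [Module K M] {n : ℕ}
    {f g : TensorAlgebra K V →ₗ[K] M}
    (h : ∀ v x, x ∈ homog K V n → f (TensorAlgebra.ι K v * x) = g (TensorAlgebra.ι K v * x))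
    {x : TensorAlgebra K V} (hx : x ∈ homog K V (n + 1)) : f x = g x := by
  obtain ⟨x, rfl⟩ := hx
  have : f ∘ₗ TensorPower.toTensorAlgebra = g ∘ₗ TensorPower.toTensorAlgebra :=
    tensorPower_linearMap_ext (n := n) fun v y => by
      simpa [toTensorAlgebra_consEquiv] using h v _ (toTensorAlgebra_mem_homog y)
  exact LinearMap.congr_fun this x

theorem homog_zero_induction {M : Type*} [AddCommGroup M] [Module K M]
    {f g : TensorAlgebra K V →ₗ[K] M} (h : f 1 = g 1)
    {x : TensorAlgebra K V} (hx : x ∈ homog K V 0) : f x = g x := by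
  obtain ⟨x, rfl⟩ := hx
  have : f ∘ₗ (TensorPower.toTensorAlgebra : (⨂[K]^0 V) →ₗ[K] _) =
      g ∘ₗ TensorPower.toTensorAlgebra := by
    ext v
    simpa [TensorAlgebra.tprod_apply] using h
  exact LinearMap.congr_fun this x

/-! ### Operators on adjacent letters, extended to words of all lengths -/

/-- `f` acting on the factors `a + 1`, `a + 2` of the words in the tensor algebra. -/
noncomputable def wordOp (f : V ⊗[K] V →ₗ[K] V ⊗[K] V) (a : ℕ) :
    Module.End K (TensorAlgebra K V) :=
  DirectSum.toModule K ℕ _ (fun n => TensorPower.toTensorAlgebra ∘ₗ opAt f n a) ∘ₗ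
    (TensorAlgebra.equivDirectSum (R := K) (M := V)).toLinearMap

theorem wordOp_toTensorAlgebra (f : V ⊗[K] V →ₗ[K] V ⊗[K] V) (a n : ℕ) (x : ⨂[K]^n V) :
    wordOp f a (TensorPower.toTensorAlgebra x) = TensorPower.toTensorAlgebra (opAt f n a x) := by
  simp only [wordOp, LinearMap.comp_apply, AlgEquiv.toLinearMap_apply,
    equivDirectSum_toTensorAlgebra, DirectSum.toModule_lof]

theorem wordOp_mem_homog (f : V ⊗[K] V →ₗ[K] V ⊗[K] V) (a : ℕ) {n : ℕ} {x : TensorAlgebra K V}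
    (hx : x ∈ homog K V n) : wordOp f a x ∈ homog K V n := by
  obtain ⟨x, rfl⟩ := hx
  rw [wordOp_toTensorAlgebra]
  exact toTensorAlgebra_mem_homog _

theorem wordOp_succ (f : V ⊗[K] V →ₗ[K] V ⊗[K] V) (a : ℕ) (v : V) (x : TensorAlgebra K V) :
    wordOp f (a + 1) (TensorAlgebra.ι K v * x) = TensorAlgebra.ι K v * wordOp f a x := by
  have : wordOp f (a + 1) ∘ₗ LinearMap.mulLeft K (TensorAlgebra.ι K v) =
      LinearMap.mulLeft K (TensorAlgebra.ι K v) ∘ₗ wordOp f a := by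
    apply tensorAlgebra_linearMap_ext
    intro n x
    simp only [LinearMap.comp_apply, LinearMap.mulLeft_apply, ← toTensorAlgebra_consEquiv,
      wordOp_toTensorAlgebra]
    congr 1
    simp [opAt, LinearEquiv.conj_apply]
  exact LinearMap.congr_fun this x

variable (K V) in
/-- The image of `V ⊗ V` in the tensor algebra. -/
noncomputable def pairMul : V ⊗[K] V →ₗ[K] TensorAlgebra K V :=
  LinearMap.mul' K (TensorAlgebra K V) ∘ₗ
    TensorProduct.map (TensorAlgebra.ι K) (TensorAlgebra.ι K)

@[simp]
theorem pairMul_tmul (v w : V) :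
    pairMul K V (v ⊗ₜ w) = TensorAlgebra.ι K v * TensorAlgebra.ι K w := by
  simp [pairMul]

theorem wordOp_zero (f : V ⊗[K] V →ₗ[K] V ⊗[K] V) (v w : V) (x : TensorAlgebra K V) :
    wordOp f 0 (TensorAlgebra.ι K v * (TensorAlgebra.ι K w * x)) =
      pairMul K V (f (v ⊗ₜ w)) * x := by
  have : wordOp f 0 ∘ₗ LinearMap.mulLeft K (TensorAlgebra.ι K v) ∘ₗ
      LinearMap.mulLeft K (TensorAlgebra.ι K w) =
      LinearMap.mulLeft K (pairMul K V (f (v ⊗ₜ w))) := by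
    apply tensorAlgebra_linearMap_ext
    intro n x
    simp only [LinearMap.comp_apply, LinearMap.mulLeft_apply, ← toTensorAlgebra_consEquiv,
      wordOp_toTensorAlgebra]
    have h : ∀ t : V ⊗[K] V, TensorPower.toTensorAlgebra (consEquiv K V (n + 1)
        (LinearMap.lTensor V (consEquiv K V n).toLinearMap
          (TensorProduct.assoc K V V _ (t ⊗ₜ x)))) =
        pairMul K V t * TensorPower.toTensorAlgebra x := by
      intro t
      induction t with
      | zero => simp
      | tmul a b => simp [toTensorAlgebra_consEquiv, mul_assoc]
      | add a b ha hb => simp only [TensorProduct.add_tmul, map_add, ha, hb, add_mul]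
    rw [← h]
    simp [opAt, LinearEquiv.conj_apply, onFirstTwo]
  exact LinearMap.congr_fun this x

theorem wordOp_zero_of_tmul {f : V ⊗[K] V →ₗ[K] V ⊗[K] V} {v w v' w' : V}
    (h : f (v ⊗ₜ w) = v' ⊗ₜ w') (x : TensorAlgebra K V) :
    wordOp f 0 (TensorAlgebra.ι K v * (TensorAlgebra.ι K w * x)) =
      TensorAlgebra.ι K v' * (TensorAlgebra.ι K w' * x) := by
  rw [wordOp_zero, h, pairMul_tmul, mul_assoc]

/-- A single letter leaves no room for the operator, and `opAt` is then the identity by default. -/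
theorem wordOp_zero_ι (f : V ⊗[K] V →ₗ[K] V ⊗[K] V) (v : V) :
    wordOp f 0 (TensorAlgebra.ι K v) = TensorAlgebra.ι K v := by
  obtain ⟨x, hx⟩ := ι_mem_homog (K := K) v
  rw [← hx, wordOp_toTensorAlgebra]
  rfl

theorem wordOp_one (f : V ⊗[K] V →ₗ[K] V ⊗[K] V) (a : ℕ) :
    wordOp f a (1 : TensorAlgebra K V) = 1 := by
  obtain ⟨x, hx⟩ := one_mem_homog (K := K) (V := V)
  rw [← hx, wordOp_toTensorAlgebra]
  rfl

/-- `f_{a+1} f_{a+2} ⋯ f_{a+l}` on the words in the tensor algebra. -/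
noncomputable def wordRun (f : V ⊗[K] V →ₗ[K] V ⊗[K] V) (a l : ℕ) :
    Module.End K (TensorAlgebra K V) :=
  ((List.range' a l).map (wordOp f)).prod

theorem wordRun_succ (f : V ⊗[K] V →ₗ[K] V ⊗[K] V) (a l : ℕ) (x : TensorAlgebra K V) :
    wordRun f a (l + 1) x = wordOp f a (wordRun f (a + 1) l x) := by
  simp [wordRun, List.range'_succ]

@[simp]
theorem wordRun_zero (f : V ⊗[K] V →ₗ[K] V ⊗[K] V) (a : ℕ) (x : TensorAlgebra K V) :
    wordRun f a 0 x = x := by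
  simp [wordRun]

theorem wordRun_mem_homog (f : V ⊗[K] V →ₗ[K] V ⊗[K] V) (a l : ℕ) {n : ℕ}
    {x : TensorAlgebra K V} (hx : x ∈ homog K V n) : wordRun f a l x ∈ homog K V n := by
  induction l generalizing a with
  | zero => simpa
  | succ l ih => rw [wordRun_succ]; exact wordOp_mem_homog f a (ih _)

theorem wordRun_ι_mul (f : V ⊗[K] V →ₗ[K] V ⊗[K] V) (a l : ℕ) (v : V) (x : TensorAlgebra K V) :
    wordRun f (a + 1) l (TensorAlgebra.ι K v * x) = TensorAlgebra.ι K v * wordRun f a l x := by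
  induction l generalizing a with
  | zero => simp
  | succ l ih => rw [wordRun_succ, ih, wordOp_succ, wordRun_succ]

/-- A prefix of `k` letters only shifts the place of the operator. Working in the tensor algebra
keeps such shifts free of casts between tensor powers. -/
theorem wordOp_homog_mul (f : V ⊗[K] V →ₗ[K] V ⊗[K] V) (a k : ℕ) {y : TensorAlgebra K V}
    (hy : y ∈ homog K V k) (x : TensorAlgebra K V) :
    wordOp f (k + a) (y * x) = y * wordOp f a x := by
  induction k generalizing y with
  | zero =>
    rw [zero_add]
    exact homog_zero_induction (f := wordOp f a ∘ₗ LinearMap.mulRight K x)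
      (g := LinearMap.mulRight K (wordOp f a x)) (by simp) hy
  | succ k ih =>
    refine homog_induction (f := wordOp f (k + 1 + a) ∘ₗ LinearMap.mulRight K x)
      (g := LinearMap.mulRight K (wordOp f a x)) (fun v z hz => ?_) hy
    simp only [LinearMap.comp_apply, LinearMap.mulRight_apply, mul_assoc]
    rw [show k + 1 + a = k + a + 1 by omega, wordOp_succ, ih hz]

theorem wordRun_homog_mul (f : V ⊗[K] V →ₗ[K] V ⊗[K] V) (a l k : ℕ) {y : TensorAlgebra K V}
    (hy : y ∈ homog K V k) (x : TensorAlgebra K V) :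
    wordRun f (k + a) l (y * x) = y * wordRun f a l x := by
  induction l generalizing a with
  | zero => simp
  | succ l ih => rw [wordRun_succ, add_assoc, ih, wordOp_homog_mul f a k hy, wordRun_succ]

theorem wordRun_toTensorAlgebra (f : V ⊗[K] V →ₗ[K] V ⊗[K] V) (a l n : ℕ) (x : ⨂[K]^n V) :
    wordRun f a l (TensorPower.toTensorAlgebra x) =
      TensorPower.toTensorAlgebra (((List.range' a l).map (opAt f n)).prod x) := by
  induction l generalizing a with
  | zero => simp
  | succ l ih =>
    rw [wordRun_succ, ih, wordOp_toTensorAlgebra, List.range'_succ]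
    simp

/-- A vector that is braided with all vectors by the flip moves to the front of a word. -/
theorem wordRun_mul_ι {f : V ⊗[K] V →ₗ[K] V ⊗[K] V} {e : V} (hf : ∀ v, f (v ⊗ₜ e) = e ⊗ₜ v)
    (k : ℕ) {y : TensorAlgebra K V} (hy : y ∈ homog K V k) (x : TensorAlgebra K V) :
    wordRun f 0 k (y * (TensorAlgebra.ι K e * x)) = TensorAlgebra.ι K e * (y * x) := by
  induction k generalizing y with
  | zero =>
    simp only [wordRun_zero]
    exact homog_zero_induction (f := LinearMap.mulRight K (TensorAlgebra.ι K e * x))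
      (g := LinearMap.mulLeft K (TensorAlgebra.ι K e) ∘ₗ LinearMap.mulRight K x) (by simp) hy
  | succ k ih =>
    refine homog_induction
      (f := wordRun f 0 (k + 1) ∘ₗ LinearMap.mulRight K (TensorAlgebra.ι K e * x))
      (g := LinearMap.mulLeft K (TensorAlgebra.ι K e) ∘ₗ LinearMap.mulRight K x)
      (fun v z hz => ?_) hy
    simp only [LinearMap.comp_apply, LinearMap.mulRight_apply, LinearMap.mulLeft_apply, mul_assoc]
    rw [wordRun_succ, wordRun_ι_mul, ih hz, wordOp_zero_of_tmul (hf v)]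

/-! ### Functoriality in the space of letters -/

/-- The algebra homomorphism of tensor algebras induced by a linear map. -/
noncomputable def wordMap {W : Type*} [AddCommGroup W] [Module K W] (φ : V →ₗ[K] W) :
    TensorAlgebra K V →ₐ[K] TensorAlgebra K W :=
  TensorAlgebra.lift K (TensorAlgebra.ι K ∘ₗ φ)

@[simp]
theorem wordMap_ι {W : Type*} [AddCommGroup W] [Module K W] (φ : V →ₗ[K] W) (v : V) :
    wordMap φ (TensorAlgebra.ι K v) = TensorAlgebra.ι K (φ v) := by
  simp [wordMap]

/-- Linear maps of vector spaces with operators induce maps of tensor algebras that are compatible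
with the operators. -/
theorem wordMap_wordOp {W : Type*} [AddCommGroup W] [Module K W] (φ : V →ₗ[K] W)
    {f : V ⊗[K] V →ₗ[K] V ⊗[K] V} {g : W ⊗[K] W →ₗ[K] W ⊗[K] W}
    (h : ∀ t, TensorProduct.map φ φ (f t) = g (TensorProduct.map φ φ t)) (a : ℕ)
    (x : TensorAlgebra K V) :
    wordMap φ (wordOp f a x) = wordOp g a (wordMap φ x) := by
  suffices H : (wordMap φ).toLinearMap ∘ₗ wordOp f a =
      wordOp g a ∘ₗ (wordMap φ).toLinearMap from LinearMap.congr_fun H x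
  apply tensorAlgebra_linearMap_ext
  intro n x
  induction a generalizing n with
  | zero =>
    -- Words with fewer than two letters are left alone on both sides and need separate treatment.
    match n, x with
    | 0, x =>
      exact homog_zero_induction (by simp [wordOp_one]) (toTensorAlgebra_mem_homog x)
    | 1, x =>
      refine homog_induction (n := 0) (fun v y hy => ?_) (toTensorAlgebra_mem_homog x)
      refine homog_zero_induction
        (f := ((wordMap φ).toLinearMap ∘ₗ wordOp f 0) ∘ₗ
          LinearMap.mulLeft K (TensorAlgebra.ι K v))
        (g := (wordOp g 0 ∘ₗ (wordMap φ).toLinearMap) ∘ₗ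
          LinearMap.mulLeft K (TensorAlgebra.ι K v)) ?_ hy
      simp [wordOp_zero_ι]
    | n + 2, x =>
      refine homog_induction (n := n + 1) (fun v y hy => ?_) (toTensorAlgebra_mem_homog x)
      refine homog_induction
        (f := ((wordMap φ).toLinearMap ∘ₗ wordOp f 0) ∘ₗ
          LinearMap.mulLeft K (TensorAlgebra.ι K v))
        (g := (wordOp g 0 ∘ₗ (wordMap φ).toLinearMap) ∘ₗ
          LinearMap.mulLeft K (TensorAlgebra.ι K v)) (fun w z _ => ?_) hy
      have hp : ∀ t, wordMap φ (pairMul K V t) =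
          pairMul K W (TensorProduct.map φ φ t) := by
        intro t
        induction t with
        | zero => simp
        | tmul a b => simp
        | add a b ha hb => simp only [map_add, ha, hb]
      simp only [LinearMap.comp_apply, LinearMap.mulLeft_apply, AlgHom.toLinearMap_apply, map_mul,
        wordMap_ι, wordOp_zero, hp, h, TensorProduct.map_tmul]
  | succ a ih =>
    match n, x with
    | 0, x =>
      exact homog_zero_induction (by simp [wordOp_one]) (toTensorAlgebra_mem_homog x)
    | n + 1, x =>
      refine homog_induction (n := n) (fun v y hy => ?_) (toTensorAlgebra_mem_homog x)
      obtain ⟨y, rfl⟩ := hy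
      have := ih n y
      simp only [LinearMap.comp_apply, AlgHom.toLinearMap_apply, map_mul, wordOp_succ,
        wordMap_ι] at this ⊢
      rw [this]

theorem wordMap_wordRun {W : Type*} [AddCommGroup W] [Module K W] (φ : V →ₗ[K] W)
    {f : V ⊗[K] V →ₗ[K] V ⊗[K] V} {g : W ⊗[K] W →ₗ[K] W ⊗[K] W}
    (h : ∀ t, TensorProduct.map φ φ (f t) = g (TensorProduct.map φ φ t)) (a l : ℕ)
    (x : TensorAlgebra K V) :
    wordMap φ (wordRun f a l x) = wordRun g a l (wordMap φ x) := by
  induction l generalizing a with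
  | zero => simp
  | succ l ih => rw [wordRun_succ, wordMap_wordOp φ h, ih, wordRun_succ]

theorem wordMap_mem_homog {W : Type*} [AddCommGroup W] [Module K W] (φ : V →ₗ[K] W) {n : ℕ}
    {x : TensorAlgebra K V} (hx : x ∈ homog K V n) :
    wordMap φ x ∈ homog K W n := by
  obtain ⟨x, rfl⟩ := hx
  induction x using PiTensorProduct.induction_on with
  | smul_tprod r v =>
    rw [map_smul, map_smul]
    refine Submodule.smul_mem _ _ ⟨PiTensorProduct.tprod K fun a => φ (v a), ?_⟩
    simp [TensorAlgebra.tprod_apply, map_list_prod, List.map_ofFn, Function.comp_def]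
  | add x y hx hy => rw [map_add, map_add]; exact Submodule.add_mem _ hx hy

end tensorAlgebra

/-! ## The quantum quasi-shuffle product on words -/

section quasiShuffle

variable {K V : Type*} [Field K] [AddCommGroup V] [Module K V]

theorem consWith_consEquiv {n : ℕ} (f : (⨂[K]^n V) →ₗ[K] TensorAlgebra K V) (v : V)
    (x : ⨂[K]^n V) :
    consWith f (consEquiv K V n (v ⊗ₜ x)) = TensorAlgebra.ι K v * f x := by
  simp [consWith]

theorem mulFirst_consEquiv (A : BraidedAlgebra K V) (n : ℕ) (u v : V) (x : ⨂[K]^n V) :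
    mulFirst A n (consEquiv K V (n + 1) (u ⊗ₜ consEquiv K V n (v ⊗ₜ x))) =
      consEquiv K V n (A.m (u ⊗ₜ v) ⊗ₜ x) := by
  simp [mulFirst]

theorem quasiShuffle_of_zero (A : BraidedAlgebra K V) (n : ℕ) :
    quasiShuffle A n 0 = TensorPower.toTensorAlgebra := by
  match n with
  | 0 => rfl
  | 1 => rfl
  | n + 2 => rfl

theorem quasiShuffle_of_le (A : BraidedAlgebra K V) (n p : ℕ) (h : n ≤ p) :
    quasiShuffle A n p = TensorPower.toTensorAlgebra := by
  match n, p with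
  | 0, _ => rfl
  | 1, _ => rfl
  | n + 2, 0 => omega
  | n + 2, p + 1 => rw [quasiShuffle, if_pos h]

/-- The braiding runs are rewritten by starting place and length, the form that `wordRun` uses. -/
theorem quasiShuffle_succ (A : BraidedAlgebra K V) (n p : ℕ) (h : p + 1 < n + 2) :
    quasiShuffle A (n + 2) (p + 1) =
      consWith (quasiShuffle A (n + 1) p) +
      consWith (quasiShuffle A (n + 1) (p + 1)) ∘ₗ
        ((List.range' 0 (p + 1)).map (opAt A.σ (n + 2))).prod +
      consWith (quasiShuffle A n p) ∘ₗ mulFirst A n ∘ₗ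
        ((List.range' 1 p).map (opAt A.σ (n + 2))).prod := by
  rw [quasiShuffle, if_neg (by omega)]
  simp [runProd]

theorem qstar_toTensorAlgebra (A : BraidedAlgebra K V) (p q : ℕ) (x : ⨂[K]^p V)
    (y : ⨂[K]^q V) :
    qstar A (TensorPower.toTensorAlgebra x) (TensorPower.toTensorAlgebra y) =
      quasiShuffle A (p + q) p (TensorPower.mulEquiv (x ⊗ₜ y)) := by
  simp only [qstar, LinearMap.comp_apply, AlgEquiv.toLinearMap_apply,
    equivDirectSum_toTensorAlgebra, DirectSum.toModule_lof, LinearMap.flip_apply]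
  simp [quasiShufflePow]

theorem toTensorAlgebra_mulEquiv (p q : ℕ) (x : ⨂[K]^p V) (y : ⨂[K]^q V) :
    TensorPower.toTensorAlgebra (TensorPower.mulEquiv (x ⊗ₜ[K] y)) =
      TensorPower.toTensorAlgebra x * TensorPower.toTensorAlgebra y :=
  TensorPower.toTensorAlgebra_gMul x y

end quasiShuffle

/-! ## Sums of lifts of products of shuffles -/

/-- Since `shiftPerm l` is conjugation, hence a bijection of the whole group, this lets the sum over
`w` in M' become a sum over shuffles of the last positions. -/
theorem isShuffle_shiftPerm_iff {n l p q : ℕ} (hn : l + p + q = n) (w : Equiv.Perm (Fin n)) :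
    IsShuffle l p q (shiftPerm l w) ↔ IsShuffle 0 p q w := by
  constructor
  · intro hw
    have hfix : ∀ a : Fin n, n - l ≤ a.val → w a = a := by
      intro a ha
      -- The last `l` positions wrap around to the first `l`, which the shifted permutation fixes.
      have h1 : ((finRotate n ^ l) a).val < l := by
        rw [finRotate_pow_apply, show a.val + l = n + (a.val + l - n) by omega,
          Nat.add_mod_left]
        have := Nat.mod_le (a.val + l - n) n
        omega
      have h2 := hw.fixed _ (Or.inl h1)
      simpa [shiftPerm] using h2
    have hlt : ∀ a b : Fin n, ∀ (ha : a.val + l < n) (hb : b.val + l < n),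
        shiftPerm l w ⟨a.val + l, ha⟩ < shiftPerm l w ⟨b.val + l, hb⟩ → w a < w b := by
      intro a b ha hb h
      rw [Fin.lt_def, shiftPerm_apply_add l w hfix a _ rfl,
        shiftPerm_apply_add l w hfix b _ rfl] at h
      rw [Fin.lt_def]
      omega
    refine ⟨fun a ha => hfix a (by omega), fun a b ha hab hb => ?_, fun a b ha hab hb => ?_⟩
    · exact hlt a b (by omega) (by omega)
        (hw.left _ _ (by simp) (Fin.lt_def.mpr (by simp only; omega)) (by simp only; omega))
    · exact hlt a b (by omega) (by omega)
        (hw.right _ _ (by simp only; omega) (Fin.lt_def.mpr (by simp only; omega))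
          (by simp only; omega))
  · intro hw
    have hfix : ∀ a : Fin n, n - l ≤ a.val → w a = a := fun a ha => hw.fixed a (by omega)
    have hlt : ∀ a b : Fin n, ∀ (ha : l ≤ a.val) (hb : l ≤ b.val),
        w ⟨a.val - l, by omega⟩ < w ⟨b.val - l, by omega⟩ →
          shiftPerm l w a < shiftPerm l w b := by
      intro a b ha hb h
      rw [Fin.lt_def] at h
      rw [Fin.lt_def, shiftPerm_apply_add l w hfix ⟨a.val - l, by omega⟩ a (by simp only; omega),
        shiftPerm_apply_add l w hfix ⟨b.val - l, by omega⟩ b (by simp only; omega)]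
      omega
    refine ⟨fun a ha => shiftPerm_apply_of_lt l w hfix (by omega) a (by omega),
      fun a b ha hab hb => ?_, fun a b ha hab hb => ?_⟩
    · exact hlt a b (by omega) (by omega)
        (hw.left _ _ (by simp) (Fin.lt_def.mpr (by simp only; omega)) (by simp only; omega))
    · exact hlt a b (by omega) (by omega)
        (hw.right _ _ (by simp only; omega) (Fin.lt_def.mpr (by simp only; omega))
          (by simp only; omega))

/-- Fixed letters at the end may be counted in the right block, since they stay in order behind the
others. -/
theorem IsShuffle.of_add_eq {n p q q' : ℕ} {w : Equiv.Perm (Fin n)} (hw : IsShuffle 0 p q w)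
    (hn : p + q' = n) : IsShuffle 0 p q' w := by
  have htail : ∀ c : Fin n, p + q ≤ c.val → w c = c := fun c hc => hw.fixed c (by omega)
  refine ⟨fun a ha => by omega, hw.left, fun a b ha hab hb => ?_⟩
  rcases lt_or_ge b.val (p + q) with hb' | hb'
  · exact hw.right a b ha hab (by omega)
  · rw [htail b hb']
    rcases lt_or_ge a.val (p + q) with ha' | ha'
    -- Otherwise the letter at `a` lands among the fixed positions at the end; by injectivity it was
    -- already there.
    · by_contra h
      have h' := w.injective (htail (w a) (hb'.trans (not_lt.mp h)))
      rw [h'] at h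
      exact h hab
    · rwa [htail a ha']

section sums

variable {K : Type*} [Field K]

/-! ### Operators depending on the virtual length -/

/-- The linear extension of `τ ↦ F(l_v(τ)) τ`. -/
noncomputable def twist {n : ℕ} (F : ℕ → MonoidAlgebra K (GVBMonoid n)) :
    MonoidAlgebra K (GVBMonoid n) →ₗ[K] MonoidAlgebra K (GVBMonoid n) :=
  Finsupp.linearCombination K
      (fun τ => F (virtualLength τ) * MonoidAlgebra.of K (GVBMonoid n) τ) ∘ₗ
    (MonoidAlgebra.coeffLinearEquiv K).toLinearMap

theorem twist_of {n : ℕ} (F : ℕ → MonoidAlgebra K (GVBMonoid n)) (τ : GVBMonoid n) :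
    twist F (MonoidAlgebra.of K _ τ) = F (virtualLength τ) * MonoidAlgebra.of K _ τ := by
  simp [twist]

theorem virtualLength_mul {n : ℕ} (τ τ' : GVBMonoid n) :
    virtualLength (τ * τ') = virtualLength τ + virtualLength τ' := by
  simp [virtualLength]

theorem virtualLength_one (n : ℕ) : virtualLength (1 : GVBMonoid n) = 0 := by
  simp [virtualLength]

theorem twist_one {n : ℕ} (F : ℕ → MonoidAlgebra K (GVBMonoid n)) : twist F 1 = F 0 := by
  have := twist_of F 1
  rwa [map_one, virtualLength_one, mul_one] at this

/-- The virtual length is additive, so a monoid element on the right can be split off at the cost of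
shifting the argument of `F`. For the ξ-term of the recursion the shift is 1. -/
theorem twist_mul_of {n : ℕ} (F : ℕ → MonoidAlgebra K (GVBMonoid n))
    (x : MonoidAlgebra K (GVBMonoid n)) (τ : GVBMonoid n) :
    twist F (x * MonoidAlgebra.of K _ τ) =
      twist (fun l => F (l + virtualLength τ)) x * MonoidAlgebra.of K _ τ := by
  induction x using MonoidAlgebra.induction_on with
  | of τ' => rw [← map_mul, twist_of, twist_of, virtualLength_mul, map_mul, mul_assoc]
  | add x y hx hy => simp only [add_mul, map_add, hx, hy]
  | smul r x hx => simp only [smul_mul_assoc, map_smul, hx]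

theorem sum_liftMulMonoid {n p q : ℕ} (hn : p + q = n) (τ : GVBMonoid n) :
    ∑ w : Equiv.Perm (Fin n), liftMulMonoid K p q w τ =
      (if virtualLength τ < q then
        shuffleSum K n (virtualLength τ) p (q - virtualLength τ) else 0) *
          MonoidAlgebra.of K _ τ := by
  split_ifs with hl
  · have hn' : virtualLength τ + p + (q - virtualLength τ) = n := by omega
    have h := Equiv.sum_comp (MulAut.conj (finRotate n ^ virtualLength τ)).toEquiv fun w =>
      liftShuffle K (virtualLength τ) p (q - virtualLength τ) w * MonoidAlgebra.of K _ τ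
    rw [shuffleSum, Finset.sum_mul, ← h]
    refine Finset.sum_congr rfl fun w _ => ?_
    change _ = liftShuffle K _ _ _ (shiftPerm (virtualLength τ) w) * _
    rw [liftMulMonoid]
    split_ifs with h1
    · rfl
    · rw [liftShuffle, if_neg fun h2 => h1 ⟨hl, (isShuffle_shiftPerm_iff hn' w).mp h2⟩, zero_mul]
  · rw [zero_mul]
    exact Finset.sum_eq_zero fun w _ => if_neg fun h => hl h.1

theorem sum_liftMul {n p q : ℕ} (hn : p + q = n) (x : MonoidAlgebra K (GVBMonoid n)) :
    ∑ w : Equiv.Perm (Fin n), liftMul K p q w x =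
      twist (fun l => if l < q then shuffleSum K n l p (q - l) else 0) x := by
  simp only [liftMul, twist, LinearMap.comp_apply, Finsupp.linearCombination_apply, Finsupp.sum]
  rw [Finset.sum_comm]
  refine Finset.sum_congr rfl fun τ _ => ?_
  rw [← Finset.smul_sum, sum_liftMulMonoid hn]

/-- M'(w, τ) can be nonzero only if `w` is a shuffle with a possibly shorter right block, and such a
permutation is also a `(p, q)`-shuffle. The outer sum may therefore run over all permutations. -/
theorem liftMul_eq_zero {n p q : ℕ} (hn : p + q = n) (w : Equiv.Perm (Fin n))
    (hw : ¬ IsShuffle 0 p q w) : liftMul K p q w = 0 := by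
  have : liftMulMonoid K p q w = 0 :=
    funext fun τ => if_neg fun h => hw (h.2.of_add_eq hn)
  simp [liftMul, this]

/-- The factorisation bijection turns the left side into a sum over pairs of shuffles. By the
extensions by zero both factors may range over the whole group, and linearity of `liftMul` lets the
two sums be taken one after the other. -/
theorem sum_liftTwo {n i j : ℕ} (hij : i < j) (hj : j < n) :
    ∑ w ∈ desLE n {i, j}, liftTwo K i j w =
      twist (fun l => if l < n - i then shuffleSum K n l i (n - i - l) else 0)
        (shuffleSum K n i (j - i) (n - j)) := by
  classical
  have h1 : ∑ w ∈ desLE n {i, j}, liftTwo K i j w =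
      ∑ x ∈ (Finset.univ.filter fun L : Equiv.Perm (Fin n) => IsShuffle 0 i (n - i) L) ×ˢ
        (Finset.univ.filter fun R : Equiv.Perm (Fin n) => IsShuffle i (j - i) (n - j) R),
        liftMul K i (n - i) x.1 (liftShuffle K i (j - i) (n - j) x.2) := by
    refine Finset.sum_bij' (fun w _ => (leftFactor i w, rightFactor i w)) (fun x _ => x.1 * x.2)
      ?_ ?_ ?_ ?_ ?_
    · intro w hw
      simpa using factors_isShuffle hij hj w hw
    · rintro ⟨L, R⟩ h
      simp only [Finset.mem_product, Finset.mem_filter, Finset.mem_univ, true_and] at h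
      exact (factors_mul hij hj L R h.1 h.2).1
    · intro w _
      exact leftFactor_mul_rightFactor i w
    · rintro ⟨L, R⟩ h
      simp only [Finset.mem_product, Finset.mem_filter, Finset.mem_univ, true_and] at h
      exact Prod.ext (factors_mul hij hj L R h.1 h.2).2.1 (factors_mul hij hj L R h.1 h.2).2.2
    · intro w _
      rfl
  rw [h1, Finset.sum_product_right, ← sum_liftMul (by omega), shuffleSum]
  simp only [map_sum]
  rw [Finset.sum_comm (s := Finset.univ) (t := Finset.univ), Finset.sum_filter]
  refine Finset.sum_congr rfl fun R _ => ?_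
  split_ifs with hR
  · rw [Finset.sum_filter]
    refine Finset.sum_congr rfl fun L _ => ?_
    split_ifs with hL
    · rfl
    · rw [liftMul_eq_zero (by omega) L hL, LinearMap.zero_apply]
  · simp [liftShuffle, hR]

/-- No range condition is needed: outside the range the default value 1 also has virtual length 0.
For ξ the range does matter. -/
theorem sigAlg_eq_of {n m : ℕ} :
    ∃ τ : GVBMonoid n, virtualLength τ = 0 ∧ sigAlg K n m = MonoidAlgebra.of K _ τ := by
  unfold sigAlg
  split_ifs with h
  · refine ⟨_, ?_, rfl⟩
    simp [virtualLength, virtualLengthHom]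
  · exact ⟨1, virtualLength_one n, (map_one _).symm⟩

theorem runProd_sigAlg_eq_of {n : ℕ} (a b : ℕ) :
    ∃ τ : GVBMonoid n, virtualLength τ = 0 ∧
      runProd (sigAlg K n) a b = MonoidAlgebra.of K _ τ := by
  unfold runProd
  generalize b + 1 - a = l
  induction l generalizing a with
  | zero => exact ⟨1, virtualLength_one n, by rw [map_one]; simp⟩
  | succ l ih =>
    obtain ⟨τ, h1, h2⟩ := ih (a + 1)
    obtain ⟨τ', h1', h2'⟩ := sigAlg_eq_of (K := K) (n := n) (m := a)
    refine ⟨τ' * τ, by rw [virtualLength_mul, h1, h1'], ?_⟩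
    rw [List.range'_succ, List.map_cons, List.prod_cons, h2, h2', map_mul]

theorem xiAlg_eq_of {n m : ℕ} (hm : 1 ≤ m) (hmn : m < n) :
    ∃ τ : GVBMonoid n, virtualLength τ = 1 ∧ xiAlg K n m = MonoidAlgebra.of K _ τ := by
  rw [xiAlg, dif_pos ⟨hm, hmn⟩]
  refine ⟨_, ?_, rfl⟩
  simp [virtualLength, virtualLengthHom]

end sums

/-! ## The action on words -/

section action

variable {K W : Type*} [Field K] [AddCommGroup W] [Module K W]

/-- The action of the algebra of `GVB_n⁺` on the words of length `n` in the tensor algebra. -/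
noncomputable def gvbOp (B : BraidedAlgebra K W) {e : W} (he : IsBraidedUnit B e) (n : ℕ)
    (x : MonoidAlgebra K (GVBMonoid n)) : Module.End K (TensorAlgebra K W) :=
  TensorPower.toTensorAlgebra ∘ₗ gvbRep B he n x ∘ₗ
    DirectSum.component K ℕ (fun n => ⨂[K]^n W) n ∘ₗ
      (TensorAlgebra.equivDirectSum (R := K) (M := W)).toLinearMap

variable (B : BraidedAlgebra K W) {e : W} (he : IsBraidedUnit B e) {n : ℕ}

theorem gvbOp_toTensorAlgebra (x : MonoidAlgebra K (GVBMonoid n)) (t : ⨂[K]^n W) :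
    gvbOp B he n x (TensorPower.toTensorAlgebra t) =
      TensorPower.toTensorAlgebra (gvbRep B he n x t) := by
  simp only [gvbOp, LinearMap.comp_apply, AlgEquiv.toLinearMap_apply,
    equivDirectSum_toTensorAlgebra, DirectSum.component.lof_self]

theorem gvbOp_add (x y : MonoidAlgebra K (GVBMonoid n)) :
    gvbOp B he n (x + y) = gvbOp B he n x + gvbOp B he n y := by
  ext1 t
  simp [gvbOp]

theorem gvbOp_one {t : TensorAlgebra K W} (ht : t ∈ homog K W n) : gvbOp B he n 1 t = t := by
  obtain ⟨t, rfl⟩ := ht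
  simp [gvbOp_toTensorAlgebra]

/-- `gvbOp` projects to degree `n` first, so it is multiplicative there, but it annihilates all
other degrees. -/
theorem gvbOp_mul (x y : MonoidAlgebra K (GVBMonoid n)) {t : TensorAlgebra K W}
    (ht : t ∈ homog K W n) : gvbOp B he n (x * y) t = gvbOp B he n x (gvbOp B he n y t) := by
  obtain ⟨t, rfl⟩ := ht
  simp [gvbOp_toTensorAlgebra]

theorem gvbOp_sigAlg (a : ℕ) (ha : a + 1 < n) {t : TensorAlgebra K W} (ht : t ∈ homog K W n) :
    gvbOp B he n (sigAlg K n (a + 1)) t = wordOp B.σ a t := by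
  obtain ⟨t, rfl⟩ := ht
  rw [gvbOp_toTensorAlgebra, wordOp_toTensorAlgebra, sigAlg, dif_pos ⟨by omega, ha⟩, gvbRep,
    MonoidAlgebra.lift_of]
  rfl

theorem gvbOp_xiAlg (a : ℕ) (ha : a + 1 < n) {t : TensorAlgebra K W} (ht : t ∈ homog K W n) :
    gvbOp B he n (xiAlg K n (a + 1)) t = wordOp (sigmaM B e) a t := by
  obtain ⟨t, rfl⟩ := ht
  rw [gvbOp_toTensorAlgebra, wordOp_toTensorAlgebra, xiAlg, dif_pos ⟨by omega, ha⟩, gvbRep,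
    MonoidAlgebra.lift_of]
  rfl

theorem gvbOp_runProd_sigAlg (a l : ℕ) (ha : a + l < n) {t : TensorAlgebra K W}
    (ht : t ∈ homog K W n) :
    gvbOp B he n (runProd (sigAlg K n) (a + 1) (a + l)) t = wordRun B.σ a l t := by
  rw [runProd, show a + l + 1 - (a + 1) = l by omega]
  induction l generalizing a with
  | zero => simpa using gvbOp_one B he ht
  | succ l ih =>
    rw [List.range'_succ, List.map_cons, List.prod_cons, gvbOp_mul B he _ _ ht,
      ih (a + 1) (by omega), gvbOp_sigAlg B he a (by omega) (wordRun_mem_homog _ _ _ ht),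
      wordRun_succ]

end action

theorem tprod_eq_prod_range' {K V : Type*} [Field K] [AddCommGroup V] [Module K V] (u : ℕ → V)
    (s m : ℕ) : (TensorAlgebra.tprod K V m fun a => u (s + a.val)) =
      ((List.range' s m).map fun a => TensorAlgebra.ι K (u a)).prod := by
  rw [TensorAlgebra.tprod_apply]
  congr 1
  apply List.ext_getElem <;> simp

/-! ### The deleting operator and the main induction -/

section main

variable {K W : Type*} [Field K] [AddCommGroup W] [Module K W]

/-- A word with all letters in `V` contains no 𝟏 to delete. -/
theorem deleteOne_wordMap {e : W} (hne : e ≠ 0) {V : Submodule K W} (hV : IsCompl (K ∙ e) V)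
    (z : TensorAlgebra K V) : deleteOne hne hV (wordMap V.subtype z) = z := by
  have : (deleteOne hne hV).comp (wordMap V.subtype) = AlgHom.id K _ := by
    ext v
    simp [deleteOne_mem hne hV v]
  exact AlgHom.congr_fun this z

/-- This matches ξ with the multiplication term of ∗: the two letters become 𝟏 followed by their
product, which is again a letter of `V`. -/
theorem wordOp_sigmaM_wordMap (B : BraidedAlgebra K W) (e : W) (V : Submodule K W)
    (A : BraidedAlgebra K V)
    (hm : ∀ t : V ⊗[K] V, (A.m t : W) = B.m (TensorProduct.map V.subtype V.subtype t))
    (n : ℕ) (x : ⨂[K]^(n + 2) V) :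
    wordOp (sigmaM B e) 0 (wordMap V.subtype (TensorPower.toTensorAlgebra x)) =
      TensorAlgebra.ι K e *
        wordMap V.subtype (TensorPower.toTensorAlgebra (mulFirst A n x)) := by
  suffices H : wordOp (sigmaM B e) 0 ∘ₗ (wordMap V.subtype).toLinearMap ∘ₗ
      TensorPower.toTensorAlgebra =
      LinearMap.mulLeft K (TensorAlgebra.ι K e) ∘ₗ (wordMap V.subtype).toLinearMap ∘ₗ
        TensorPower.toTensorAlgebra ∘ₗ mulFirst A n from LinearMap.congr_fun H x
  refine tensorPower_linearMap_ext fun u y => ?_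
  suffices H : (wordOp (sigmaM B e) 0 ∘ₗ (wordMap V.subtype).toLinearMap ∘ₗ
      TensorPower.toTensorAlgebra) ∘ₗ (consEquiv K V (n + 1)).toLinearMap ∘ₗ
        TensorProduct.mk K V _ u =
      (LinearMap.mulLeft K (TensorAlgebra.ι K e) ∘ₗ (wordMap V.subtype).toLinearMap ∘ₗ
        TensorPower.toTensorAlgebra ∘ₗ mulFirst A n) ∘ₗ (consEquiv K V (n + 1)).toLinearMap ∘ₗ
        TensorProduct.mk K V _ u from LinearMap.congr_fun H y
  refine tensorPower_linearMap_ext fun v z => ?_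
  simp only [LinearMap.comp_apply, TensorProduct.mk_apply, LinearEquiv.coe_coe,
    mulFirst_consEquiv, toTensorAlgebra_consEquiv, AlgHom.toLinearMap_apply, map_mul, wordMap_ι,
    LinearMap.mulLeft_apply]
  rw [wordOp_zero_of_tmul (v' := e) (w' := B.m ((u : W) ⊗ₜ (v : W))) (by simp [sigmaM])]
  simp [hm]

/-- The sum of the lifts of all shuffles computes the quantum quasi-shuffle product, for words
with a prefix `e ⋯ e G y` and when the lifts are followed by operators that depend on the
virtual length. -/
theorem delete_twist_shuffleSum (B : BraidedAlgebra K W) {e : W} (he : IsBraidedUnit B e)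
    (hne : e ≠ 0) (V : Submodule K W) (hV : IsCompl (K ∙ e) V) (A : BraidedAlgebra K V)
    (hσ : ∀ t : V ⊗[K] V, TensorProduct.map V.subtype V.subtype (A.σ t) =
      B.σ (TensorProduct.map V.subtype V.subtype t))
    (hm : ∀ t : V ⊗[K] V, (A.m t : W) = B.m (TensorProduct.map V.subtype V.subtype t))
    {n i : ℕ} {G : TensorAlgebra K W} (hG : G ∈ homog K W i)
    (Ψ : TensorAlgebra K V →ₗ[K] TensorAlgebra K V)
    (F : ℕ → MonoidAlgebra K (GVBMonoid n))
    (hF : ∀ (r s : ℕ) (z : TensorAlgebra K V), z ∈ homog K V s → 1 ≤ s → r + i + s = n →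
      deleteOne hne hV (gvbOp B he n (F r)
        (TensorAlgebra.ι K e ^ r * G * wordMap V.subtype z)) = Ψ z)
    (N p r c : ℕ) {y : TensorAlgebra K V} (hy : y ∈ homog K V c) (x : ⨂[K]^N V) (hp : p ≤ N)
    (hn : r + i + c + N = n) (hc : 1 ≤ c + N) :
    deleteOne hne hV (gvbOp B he n
        (twist (fun l => F (l + r)) (shuffleSum K n (r + i + c) p (N - p)))
        (TensorAlgebra.ι K e ^ r * G *
          (wordMap V.subtype y * wordMap V.subtype (TensorPower.toTensorAlgebra x)))) =
      Ψ (y * quasiShuffle A N p x) := by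
  induction N using Nat.strong_induction_on generalizing p r c y with
  | _ N IH =>
  -- If one block is empty, the only shuffle is the identity and ∗ is concatenation. Only `F` at
  -- virtual length `r` is left, and `hF` applies to the word `y x`.
  have base : p = 0 ∨ N ≤ p → deleteOne hne hV (gvbOp B he n
        (twist (fun l => F (l + r)) (shuffleSum K n (r + i + c) p (N - p)))
        (TensorAlgebra.ι K e ^ r * G *
          (wordMap V.subtype y * wordMap V.subtype (TensorPower.toTensorAlgebra x)))) =
      Ψ (y * quasiShuffle A N p x) := by
    intro h
    have hq : quasiShuffle A N p = TensorPower.toTensorAlgebra := by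
      rcases h with rfl | h
      · exact quasiShuffle_of_zero A N
      · exact quasiShuffle_of_le A N p h
    rw [shuffleSum_eq_one K n _ _ _ (by omega), twist_one, zero_add, ← map_mul, hq]
    exact hF r (c + N) _ (mul_mem_homog hy (toTensorAlgebra_mem_homog x)) hc (by omega)
  rcases Nat.eq_zero_or_pos p with h0 | h0
  · exact base (Or.inl h0)
  rcases hp.eq_or_lt with h1 | h1
  · exact base (Or.inr h1.ge)
  clear base
  obtain ⟨p, rfl⟩ : ∃ p', p = p' + 1 := ⟨p - 1, by omega⟩
  obtain ⟨N, rfl⟩ : ∃ N', N = N' + 2 := ⟨N - 2, by omega⟩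
  obtain ⟨q, hq⟩ : ∃ q, N = p + q := ⟨N - p, by omega⟩
  -- The first letter of the remaining word is final and moves to the end of `y`. Both sides are
  -- linear in the word, so the induction hypothesis need only be used after splitting off one
  -- letter.
  have cons : ∀ (N' : ℕ) (p' r' : ℕ) (x' : ⨂[K]^(N' + 1) V), N' < N + 2 → p' ≤ N' →
      r' + i + (c + 1) + N' = n →
      deleteOne hne hV (gvbOp B he n
        (twist (fun l => F (l + r')) (shuffleSum K n (r' + i + (c + 1)) p' (N' - p')))
        (TensorAlgebra.ι K e ^ r' * G *
          (wordMap V.subtype y * wordMap V.subtype (TensorPower.toTensorAlgebra x')))) =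
      Ψ (y * consWith (quasiShuffle A N' p') x') := by
    intro N' p' r' x' hN' hp' hn'
    set g := gvbOp B he n
      (twist (fun l => F (l + r')) (shuffleSum K n (r' + i + (c + 1)) p' (N' - p'))) with hg
    suffices H : (deleteOne hne hV).toLinearMap ∘ₗ g ∘ₗ
        LinearMap.mulLeft K (TensorAlgebra.ι K e ^ r' * G) ∘ₗ
        LinearMap.mulLeft K (wordMap V.subtype y) ∘ₗ (wordMap V.subtype).toLinearMap ∘ₗ
        TensorPower.toTensorAlgebra =
        Ψ ∘ₗ LinearMap.mulLeft K y ∘ₗ consWith (quasiShuffle A N' p') from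
      LinearMap.congr_fun H x'
    refine tensorPower_linearMap_ext fun u z => ?_
    have := IH N' hN' p' r' (c + 1) (mul_mem_homog hy (ι_mem_homog u)) z hp' hn' (by omega)
    rw [← hg] at this
    simpa [toTensorAlgebra_consEquiv, consWith_consEquiv, mul_assoc] using this
  -- `P` is the part of the word that the operators shuffling `x` leave in place; its length `r + i
  -- + c` is the starting position of the shuffles.
  set P := TensorAlgebra.ι K e ^ r * G * wordMap V.subtype y with hP
  have hPk : P ∈ homog K W (r + i + c) :=
    mul_mem_homog (mul_mem_homog (pow_mem_homog e r) hG) (wordMap_mem_homog _ hy)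
  set X := TensorAlgebra.ι K e ^ r * G *
    (wordMap V.subtype y * wordMap V.subtype (TensorPower.toTensorAlgebra x)) with hX
  have hXP : X = P * wordMap V.subtype (TensorPower.toTensorAlgebra x) := by
    rw [hX, hP, mul_assoc _ (wordMap V.subtype y)]
  have hXn : X ∈ homog K W n := by
    rw [hXP, ← hn]
    exact mul_mem_homog hPk (wordMap_mem_homog _ (toTensorAlgebra_mem_homog x))
  obtain ⟨τ, hτ, hτ'⟩ := runProd_sigAlg_eq_of (K := K) (n := n) (r + i + c + 1)
    (r + i + c + (p + 1))
  obtain ⟨τ₀, hτ₀, hτ₀'⟩ := runProd_sigAlg_eq_of (K := K) (n := n) 1 (r + i + c)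
  obtain ⟨τ₁, hτ₁, hτ₁'⟩ := runProd_sigAlg_eq_of (K := K) (n := n) (r + i + c + 2)
    (r + i + c + (p + 1))
  obtain ⟨ξ, hξ, hξ'⟩ := xiAlg_eq_of (K := K) (n := n) (m := r + i + c + 1) (by omega) (by omega)
  have hthird : runProd (sigAlg K n) 1 (r + i + c) * xiAlg K n (r + i + c + 1) *
      runProd (sigAlg K n) (r + i + c + 2) (r + i + c + (p + 1)) =
      MonoidAlgebra.of K _ (τ₀ * ξ * τ₁) := by
    rw [hτ₀', hτ₁', hξ', map_mul, map_mul]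
  have hlen : virtualLength (τ₀ * ξ * τ₁) = 1 := by
    rw [virtualLength_mul, virtualLength_mul, hτ₀, hτ₁, hξ]
  -- The recursion for the lifts is set against the recursion for ∗. The σ-run does not change the
  -- virtual length, while the third factor raises it by one.
  rw [show N + 2 - (p + 1) = q + 1 by omega, shuffleSum_rec K n _ p q (by omega), map_add,
    map_add, hthird, hτ', twist_mul_of, twist_mul_of, hlen, hτ, gvbOp_add, gvbOp_add,
    LinearMap.add_apply, LinearMap.add_apply, map_add, map_add, gvbOp_mul B he _ _ hXn,
    gvbOp_mul B he _ _ hXn, ← hthird, ← hτ', quasiShuffle_succ A N p (by omega)]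
  simp only [LinearMap.add_apply, mul_add, map_add, LinearMap.comp_apply, add_zero]
  congr 1
  · congr 1
    · have := cons (N + 1) p r x (by omega) (by omega) (by omega)
      rwa [show N + 1 - p = q + 1 by omega] at this
    -- Second term: behind `P` the σ-run braids the first right letter past the whole left block,
    -- and the braiding of `V` is the restriction of that of `W`.
    · have := cons (N + 1) (p + 1) r (((List.range' 0 (p + 1)).map (opAt A.σ (N + 2))).prod x)
        (by omega) (by omega) (by omega)
      rw [show N + 1 - (p + 1) = q by omega, ← wordRun_toTensorAlgebra,
        wordMap_wordRun V.subtype hσ, ← mul_assoc _ (wordMap V.subtype y), ← hP,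
        ← wordRun_homog_mul _ _ _ _ hPk, ← hXP] at this
      rw [← this, gvbOp_runProd_sigAlg B he _ _ (by omega) hXn]
      rfl
  -- Third term, with one more leading 𝟏. Read from the target backwards, the extra 𝟏 is moved from
  -- the front to just behind `P`, where it is recognised as the output of ξ applied after the
  -- shorter braiding run.
  · have := cons N p (r + 1) (mulFirst A N (((List.range' 1 p).map (opAt A.σ (N + 2))).prod x))
      (by omega) (by omega) (by omega)
    rw [show N - p = q by omega, show r + 1 + i + (c + 1) = r + i + c + 2 by omega,
      ← mul_assoc _ (wordMap V.subtype y), pow_succ', mul_assoc (TensorAlgebra.ι K e),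
      mul_assoc (TensorAlgebra.ι K e), ← hP, mul_assoc (TensorAlgebra.ι K e),
      ← wordRun_mul_ι he.one_braid _ hPk, ← wordOp_sigmaM_wordMap B e V A hm,
      ← wordRun_toTensorAlgebra, wordMap_wordRun V.subtype hσ,
      ← wordOp_homog_mul _ _ _ hPk, ← wordRun_homog_mul _ _ _ _ hPk, ← hXP] at this
    have hX₁ := wordRun_mem_homog B.σ (r + i + c + 1) p hXn
    have h₀ := gvbOp_runProd_sigAlg B he 0 (r + i + c) (by omega)
      (wordOp_mem_homog (sigmaM B e) (r + i + c) hX₁)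
    have h₁ := gvbOp_runProd_sigAlg B he (r + i + c + 1) p (by omega) hXn
    rw [zero_add, zero_add] at h₀
    rw [← this, gvbOp_mul B he _ _ hXn, show r + i + c + (p + 1) = r + i + c + 1 + p by omega,
      h₁, gvbOp_mul B he _ _ hX₁, gvbOp_xiAlg B he _ (by omega) hX₁, add_zero, h₀]
    simp only [add_assoc, add_comm 1 r]

end main

end GMT

/-! ### The product of three words -/

theorem theorem3p5 {K W : Type*} [Field K] [AddCommGroup W] [Module K W]
    (B : GMT.BraidedAlgebra K W) (e : W) (he : GMT.IsBraidedUnit B e) (hne : e ≠ 0)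
    (V : Submodule K W) (hV : IsCompl (K ∙ e) V)
    (A : GMT.BraidedAlgebra K V)
    (hσ : ∀ t : V ⊗[K] V, TensorProduct.map V.subtype V.subtype (A.σ t) =
      B.σ (TensorProduct.map V.subtype V.subtype t))
    (hm : ∀ t : V ⊗[K] V, (A.m t : W) = B.m (TensorProduct.map V.subtype V.subtype t))
    (n i j : ℕ) (hi : 1 ≤ i) (hij : i < j) (hj : j < n) (v : Fin n → V) :
    GMT.qstar A (TensorAlgebra.tprod K V i fun a => v ⟨a.val, by omega⟩)
        (GMT.qstar A
          (TensorAlgebra.tprod K V (j - i) fun a => v ⟨i + a.val, by omega⟩)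
          (TensorAlgebra.tprod K V (n - j) fun a => v ⟨j + a.val, by omega⟩)) =
      GMT.deleteOne hne hV (TensorPower.toTensorAlgebra
        (GMT.gvbRep B he n (∑ w ∈ GMT.desLE n {i, j}, GMT.liftTwo K i j w)
          (PiTensorProduct.tprod K fun a => (v a : W)))) := by
  have hword : TensorPower.toTensorAlgebra (PiTensorProduct.tprod K fun a => (v a : W)) =
      GMT.wordMap V.subtype (TensorAlgebra.tprod K V i fun a => v ⟨a.val, by omega⟩) *
        (GMT.wordMap V.subtype
            (TensorAlgebra.tprod K V (j - i) fun a => v ⟨i + a.val, by omega⟩) *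
          GMT.wordMap V.subtype
            (TensorAlgebra.tprod K V (n - j) fun a => v ⟨j + a.val, by omega⟩)) := by
    -- Extending the family of letters by 0 to all of ℕ makes each of the three subwords a product
    -- over an interval, so they can be concatenated without casts.
    obtain ⟨u, hu⟩ : ∃ u : ℕ → V, ∀ a : Fin n, u a.val = v a :=
      ⟨fun m => if h : m < n then v ⟨m, h⟩ else 0, fun a => by simp⟩
    rw [TensorPower.toTensorAlgebra_tprod]
    simp only [← hu]
    have h₁ := GMT.tprod_eq_prod_range' (K := K) (fun m => (u m : W)) 0 n
    have h₂ := GMT.tprod_eq_prod_range' (K := K) u 0 i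
    simp only [zero_add] at h₁ h₂
    rw [h₁, h₂, GMT.tprod_eq_prod_range', GMT.tprod_eq_prod_range', ← map_mul, ← map_mul,
      ← List.prod_append, ← List.prod_append, ← List.map_append, ← List.map_append,
      show List.range' i (j - i) ++ List.range' j (n - j) = List.range' i (n - i) by
        have := List.range'_append_1 (s := i) (m := j - i) (n := n - j)
        rwa [show i + (j - i) = j by omega, show j - i + (n - j) = n - i by omega] at this,
      show List.range' 0 i ++ List.range' i (n - i) = List.range' 0 n by
        have := List.range'_append_1 (s := 0) (m := i) (n := n - i)
        rwa [show 0 + i = i by omega, show i + (n - i) = n by omega] at this]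
    simp [map_list_prod, Function.comp_def]
  rw [← GMT.gvbOp_toTensorAlgebra, GMT.sum_liftTwo hij hj, hword]
  simp only [← TensorPower.toTensorAlgebra_tprod]
  set g : ⨂[K]^i V := PiTensorProduct.tprod K fun a => v ⟨a.val, by omega⟩
  set y : ⨂[K]^(j - i) V := PiTensorProduct.tprod K fun a => v ⟨i + a.val, by omega⟩
  set z : ⨂[K]^(n - j) V := PiTensorProduct.tprod K fun a => v ⟨j + a.val, by omega⟩
  -- Behind `r` letters 𝟏, the outer shuffles starting at position `r + 1` compute ∗ of the first
  -- word with any homogeneous element of positive degree that fits.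
  have hF : ∀ (r s : ℕ) (t : TensorAlgebra K V), t ∈ GMT.homog K V s → 1 ≤ s → r + i + s = n →
      GMT.deleteOne hne hV (GMT.gvbOp B he n
        (if r < n - i then GMT.shuffleSum K n r i (n - i - r) else 0)
        (TensorAlgebra.ι K e ^ r * GMT.wordMap V.subtype (TensorPower.toTensorAlgebra g) *
          GMT.wordMap V.subtype t)) =
        GMT.qstar A (TensorPower.toTensorAlgebra g) t := by
    rintro r s _ ⟨t, rfl⟩ hs hn
    -- First use of the induction: no spectator word and no later operator, so `Ψ` is the identity,
    -- and D simply removes the 𝟏's.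
    have := GMT.delete_twist_shuffleSum B he hne V hV A hσ hm (n := n) GMT.one_mem_homog
      LinearMap.id (fun _ => 1) (fun r s z hz _ hrs => by
        rw [GMT.gvbOp_one B he (by
          rw [← hrs]
          exact GMT.mul_mem_homog (GMT.mul_mem_homog (GMT.pow_mem_homog e r) GMT.one_mem_homog)
            (GMT.wordMap_mem_homog _ hz))]
        simp [GMT.deleteOne_one, GMT.deleteOne_wordMap])
      (i + s) i r 0 GMT.one_mem_homog (TensorPower.mulEquiv (g ⊗ₜ t)) (by omega) (by omega)
      (by omega)
    have htwist : ∀ x : MonoidAlgebra K (GMT.GVBMonoid n), GMT.twist (fun _ => 1) x = x := by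
      intro x
      induction x using MonoidAlgebra.induction_on with
      | of τ => rw [GMT.twist_of, one_mul]
      | add x y hx hy => rw [map_add, hx, hy]
      | smul r x hx => rw [map_smul, hx]
    rw [htwist, GMT.toTensorAlgebra_mulEquiv] at this
    simp only [map_one, map_mul, one_mul, mul_one, add_zero, LinearMap.id_apply] at this
    -- Since `1 ≤ s`, the condition `q - l > 0` in M' holds and no term is cut off.
    rw [if_pos (by omega), show n - i - r = i + s - i by omega, GMT.qstar_toTensorAlgebra,
      ← this, mul_assoc]
  -- Second use: the inner shuffles act on the last two words with the first word as spectator,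
  -- starting with no 𝟏 and no finished letter. `hF` then supplies the outer product.
  have := GMT.delete_twist_shuffleSum B he hne V hV A hσ hm (n := n)
    (GMT.wordMap_mem_homog V.subtype (GMT.toTensorAlgebra_mem_homog g))
    (GMT.qstar A (TensorPower.toTensorAlgebra g))
    (fun r => if r < n - i then GMT.shuffleSum K n r i (n - i - r) else 0) hF
    (j - i + (n - j)) (j - i) 0 0 GMT.one_mem_homog (TensorPower.mulEquiv (y ⊗ₜ z)) (by omega)
    (by omega) (by omega)
  rw [GMT.toTensorAlgebra_mulEquiv, show j - i + (n - j) - (j - i) = n - j by omega] at this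
  simp only [map_one, map_mul, one_mul, add_zero, zero_add, pow_zero] at this
  rw [GMT.qstar_toTensorAlgebra, ← this]
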